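/- Write $O(3)$ for the group of linear isometries of Euclidean space $\mathbb{R}^3$. A reflection is the orthogonal reflection in a plane through the origin, and a reflection group is a subgroup of $O(3)$ generated by reflections. For $n\ge 1$, say that a finite subgroup $G<O(3)$ is of type $(n|\circ)$ if the spherical orbifold $\mathbb{S}^2/G$ is a projective plane with one cone point of order $n$ and no other singular point; that is, the quotient space $\mathbb{S}^2/G$ is homeomorphic to $\mathbb{RP}^2$, every element of $G$ fixing a point of $\mathbb{S}^2$ is a rotation (has determinant $1$), and there is a point $x_0\in\mathbb{S}^2$ whose stabilizer in $G$ has order $n$ such that every point of $\mathbb{S}^2$ outside the orbit of $x_0$ has trivial stabilizer. (For $n=1$ all stabilizers are trivial.) Let $G<O(3)$ be a finite subgroup. Then there is a finite reflection group $G'$ with $G\le G'<O(3)$ such that $[G':G]\le 4$; moreover, if $G$ is not of type $(n|\circ)$ for any $n\ge 1$, then $G'$ can be chosen with $[G':G]\le 2$. -/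

import Mathlib

/-- Euclidean three-space. -/
abbrev E3 : Type := EuclideanSpace ℝ (Fin 3)

/-- The orthogonal group `O(3)`: all linear isometries of Euclidean three-space,
with composition as multiplication. -/
abbrev O3 : Type := E3 ≃ₗᵢ[ℝ] E3

/-- The unit sphere `S²` in Euclidean three-space. -/
abbrev S2 : Type := Metric.sphere (0 : E3) 1

/-- An element of `O(3)` is a reflection if it is the orthogonal reflection in a plane through
the origin, namely the plane orthogonal to some nonzero vector `v`. -/
def IsPlaneReflection (g : O3) : Prop :=
  ∃ v : E3, v ≠ 0 ∧ g = (Submodule.span ℝ {v})ᗮ.reflection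

/-- A reflection group in `O(3)`: a subgroup generated by a set of reflections. -/
def IsReflectionGroup (G : Subgroup O3) : Prop :=
  ∃ S : Set O3, (∀ g ∈ S, IsPlaneReflection g) ∧ G = Subgroup.closure S

/-- Points of the sphere are equivalent when they lie in the same `G`-orbit. -/
def orbitSetoid (G : Subgroup O3) : Setoid S2 where
  r x y := ∃ g ∈ G, g (x : E3) = (y : E3)
  iseqv :=
    { refl := fun _ => ⟨1, G.one_mem, rfl⟩
      symm := by
        rintro x y ⟨g, hg, h⟩
        refine ⟨g⁻¹, G.inv_mem hg, ?_⟩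
        rw [← h]
        exact g.symm_apply_apply _
      trans := by
        rintro x y z ⟨g, hg, h⟩ ⟨k, hk, h'⟩
        refine ⟨k * g, G.mul_mem hk hg, ?_⟩
        rw [← h', ← h]
        rfl }

/-- The underlying topological space of the spherical orbifold `S²/G`
(with the quotient topology). -/
abbrev SphericalQuotient (G : Subgroup O3) : Type := Quotient (orbitSetoid G)

/-- The antipodal equivalence relation on the sphere. -/
def antipodalSetoid : Setoid S2 where
  r x y := (y : E3) = x ∨ (y : E3) = -x
  iseqv :=
    { refl := fun _ => Or.inl rfl
      symm := by
        rintro x y (h | h)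
        · exact Or.inl h.symm
        · exact Or.inr (by rw [h, neg_neg])
      trans := by
        rintro x y z (h | h) (h' | h')
        · exact Or.inl (by rw [h', h])
        · exact Or.inr (by rw [h', h])
        · exact Or.inr (by rw [h', h])
        · exact Or.inl (by rw [h', h, neg_neg]) }

/-- The real projective plane: the sphere with antipodal points identified. -/
abbrev RP2 : Type := Quotient antipodalSetoid

/-- The isotropy group in `G` of a point `x` of the sphere. -/
def isotropy (G : Subgroup O3) (x : S2) : Subgroup O3 where
  carrier := {g | g ∈ G ∧ g (x : E3) = (x : E3)}
  one_mem' := ⟨G.one_mem, rfl⟩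
  mul_mem' := by
    rintro a b ⟨ha, ha'⟩ ⟨hb, hb'⟩
    refine ⟨G.mul_mem ha hb, ?_⟩
    change a (b (x : E3)) = x
    rw [hb', ha']
  inv_mem' := by
    rintro a ⟨ha, ha'⟩
    refine ⟨G.inv_mem ha, ?_⟩
    change a.symm (x : E3) = x
    exact a.symm_apply_eq.mpr ha'.symm

/-- The spherical orbifold `S²/G` has type `(n|∘)`: its underlying space is a projective plane,
it has no mirror points (all isotropy groups consist of rotations), and its only singular point
is one cone point of order `n`. For `n = 1` the cone point is an ordinary point, so that there
is no singular point at all. -/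
def HasTypeProjectivePlaneCone (n : ℕ) (G : Subgroup O3) : Prop :=
  Nonempty (SphericalQuotient G ≃ₜ RP2) ∧
  (∀ x : S2, ∀ g ∈ isotropy G x, LinearMap.det (g.toLinearEquiv : E3 →ₗ[ℝ] E3) = 1) ∧
  ∃ x₀ : S2, Nat.card (isotropy G x₀) = n ∧
    ∀ y : S2, ¬ orbitSetoid G x₀ y → isotropy G y = ⊥

open Module

/-! ### Adjoining a normalizing element whose square lies in the subgroup -/

/-! Every enlargement of `G` is built by adjoining elements that normalize a subgroup and have their
square in it, so each one at most doubles the order. The case division is whether `G` preserves a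
line.

Without an invariant line, the rotation subgroup `H` has none either (`IsAxial.of_inf_ker`).
Counting poles leaves only the orders 12, 24, 60 for `H` (`exists_pole_of_not_isAxial`) and shows
that `H` is generated by two rotations `a`, `b` about different axes. The reflection `s` in the
plane of these axes inverts both, so `H` together with `s` is the reflection group generated by `s`,
`sa`, `sb`. If `G` has improper elements, multiplying them by `-1` leads to a rotation group `K`.
Unless `K` has order 12, `-s` must lie in `K`, since otherwise `K` would extend to a rotation group
of twice its order; hence adjoining `-1` to `K` gives a reflection group.

With an invariant line through `u`, the reflection `σ` in the plane orthogonal to `u` commutes with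
`G`, and a reflection `s` in a plane through `u` inverts rotations about `u`. Adjoining one or both
gives index at most 4 (`exists_reflectionGroup_of_hasAxis`). Both are needed only if `G` consists of
rotations about `u` and rotoreflections reversing it, with `σ` not in `G`. Then, with `n` the order
of the stabilizer of `u`, raising the planar complex coordinate to the `n`-th power while keeping
its modulus and the height turns `G`-orbits into antipodal pairs, so the orbifold has type `(n|∘)`.
-/

theorem Subgroup.mem_sup_zpowers_iff_of_sq_mem {Γ : Type*} [Group Γ] {H : Subgroup Γ} {t : Γ}
    (ht : t * t ∈ H) (hn : ∀ h ∈ H, t * h * t⁻¹ ∈ H) {x : Γ} :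
    x ∈ H ⊔ Subgroup.zpowers t ↔ x ∈ H ∨ t * x ∈ H := by
  constructor
  · intro hx
    -- As `t * t ∈ H`, the cosets `tH` and `t⁻¹H` coincide, so the union of `H` and `t⁻¹H` is
    -- already a group.
    let K : Subgroup Γ :=
      { carrier := {x | x ∈ H ∨ t * x ∈ H}
        one_mem' := Or.inl H.one_mem
        mul_mem' := by
          rintro a b (ha | ha) (hb | hb)
          · exact Or.inl (H.mul_mem ha hb)
          · right
            have := H.mul_mem (hn a ha) hb
            simpa [mul_assoc] using this
          · right
            have := H.mul_mem ha hb
            simpa [mul_assoc] using this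
          · left
            have h1 := H.mul_mem (hn _ ha) hb
            have h2 := H.mul_mem (H.inv_mem ht) h1
            simpa [mul_assoc] using h2
        inv_mem' := by
          rintro a (ha | ha)
          · exact Or.inl (H.inv_mem ha)
          · right
            have h1 := H.mul_mem (hn _ (H.inv_mem ha)) ht
            simpa [mul_assoc] using h1 }
    have : H ⊔ Subgroup.zpowers t ≤ K := by
      refine sup_le (fun y hy => Or.inl hy) ?_
      rw [Subgroup.zpowers_le]
      exact Or.inr ht
    exact this hx
  · rintro (h | h)
    · exact (le_sup_left : H ≤ H ⊔ Subgroup.zpowers t) h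
    · have h1 : t * x ∈ H ⊔ Subgroup.zpowers t := (le_sup_left : H ≤ H ⊔ Subgroup.zpowers t) h
      have h2 : t ∈ H ⊔ Subgroup.zpowers t :=
        (le_sup_right : _ ≤ H ⊔ Subgroup.zpowers t) (Subgroup.mem_zpowers t)
      exact (Subgroup.mul_mem_cancel_left _ h2).1 h1

theorem Subgroup.relIndex_sup_zpowers_of_sq_mem {Γ : Type*} [Group Γ] {H : Subgroup Γ} {t : Γ}
    (ht : t * t ∈ H) (hn : ∀ h ∈ H, t * h * t⁻¹ ∈ H) (hH : t ∉ H) :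
    H.relIndex (H ⊔ Subgroup.zpowers t) = 2 := by
  rw [Subgroup.relIndex_eq_two_iff_exists_notMem_and']
  refine ⟨t, (le_sup_right : _ ≤ H ⊔ Subgroup.zpowers t) (Subgroup.mem_zpowers t), hH, ?_⟩
  intro b hb
  exact ((Subgroup.mem_sup_zpowers_iff_of_sq_mem ht hn).1 hb).symm

theorem Subgroup.relIndex_sup_zpowers_le_two {Γ : Type*} [Group Γ] {H : Subgroup Γ} {t : Γ}
    (ht : t * t ∈ H) (hn : ∀ h ∈ H, t * h * t⁻¹ ∈ H) :
    H.relIndex (H ⊔ Subgroup.zpowers t) ≤ 2 := by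
  by_cases hH : t ∈ H
  · have : H ⊔ Subgroup.zpowers t = H := by
      rw [sup_eq_left, Subgroup.zpowers_le]; exact hH
    rw [this, Subgroup.relIndex_self]; norm_num
  · rw [Subgroup.relIndex_sup_zpowers_of_sq_mem ht hn hH]

theorem Subgroup.card_mul_relIndex_eq {Γ : Type*} [Group Γ] {H K : Subgroup Γ} (h : H ≤ K) :
    Nat.card H * H.relIndex K = Nat.card K := by
  rw [← Subgroup.relIndex_bot_left H, ← Subgroup.relIndex_bot_left K]
  exact Subgroup.relIndex_mul_relIndex _ _ _ bot_le h

theorem Subgroup.card_sup_zpowers_of_sq_mem {Γ : Type*} [Group Γ] {H : Subgroup Γ} {t : Γ}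
    (ht : t * t ∈ H) (hn : ∀ h ∈ H, t * h * t⁻¹ ∈ H) (hH : t ∉ H) :
    Nat.card (H ⊔ Subgroup.zpowers t : Subgroup Γ) = Nat.card H * 2 := by
  rw [← Subgroup.relIndex_sup_zpowers_of_sq_mem ht hn hH, Subgroup.card_mul_relIndex_eq le_sup_left]

theorem Subgroup.finite_sup_zpowers_of_sq_mem {Γ : Type*} [Group Γ] {H : Subgroup Γ} [Finite H]
    {t : Γ} (ht : t * t ∈ H) (hn : ∀ h ∈ H, t * h * t⁻¹ ∈ H) :
    Finite (H ⊔ Subgroup.zpowers t : Subgroup Γ) := by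
  by_cases hH : t ∈ H
  · have : H ⊔ Subgroup.zpowers t = H := by
      rw [sup_eq_left, Subgroup.zpowers_le]; exact hH
    rw [this]; infer_instance
  · apply Nat.finite_of_card_ne_zero
    rw [Subgroup.card_sup_zpowers_of_sq_mem ht hn hH]
    have : Nat.card H ≠ 0 := Nat.card_pos.ne'
    omega

/-! ### Determinants and rotations -/

/-- The determinant as a homomorphism on `O(3)`. -/
noncomputable def detO : O3 →* ℝ where
  toFun g := LinearMap.det (g.toLinearEquiv : E3 →ₗ[ℝ] E3)
  map_one' := LinearMap.det_id
  map_mul' g h := by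
    rw [← LinearMap.det_comp]; rfl

theorem O3.mul_apply (g h : O3) (x : E3) : (g * h) x = g (h x) := rfl

theorem O3.one_apply (x : E3) : (1 : O3) x = x := rfl

theorem O3.inv_apply_eq {g : O3} {x y : E3} : g⁻¹ x = y ↔ x = g y :=
  g.symm_apply_eq

/-- The reflection in the plane orthogonal to `v`. -/
noncomputable def planeReflection (v : E3) : O3 := (Submodule.span ℝ {v})ᗮ.reflection

theorem planeReflection_mul_self (v : E3) : planeReflection v * planeReflection v = 1 :=
  Submodule.reflection_mul_reflection _

theorem planeReflection_apply_self (v : E3) : planeReflection v v = -v :=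
  Submodule.reflection_orthogonalComplement_singleton_eq_neg v

theorem planeReflection_apply_of_inner_eq_zero {v x : E3} (h : inner ℝ v x = 0) :
    planeReflection v x = x :=
  Submodule.reflection_mem_subspace_eq_self (Submodule.mem_orthogonal_singleton_iff_inner_right.2 h)

theorem planeReflection_zero : planeReflection 0 = 1 := by
  ext1 x
  exact planeReflection_apply_of_inner_eq_zero (inner_zero_left x)

theorem detO_planeReflection {v : E3} (hv : v ≠ 0) : detO (planeReflection v) = -1 := by
  have h := Submodule.det_reflection (Submodule.span ℝ {v})ᗮ
  rw [Submodule.orthogonal_orthogonal, finrank_span_singleton hv, pow_one] at h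
  exact h

theorem detO_neg : detO (LinearIsometryEquiv.neg ℝ : O3) = -1 := by
  have h := Submodule.det_reflection (⊥ : Submodule ℝ E3)
  rw [Submodule.bot_orthogonal_eq_top, finrank_top, finrank_euclideanSpace_fin] at h
  rw [← Submodule.reflection_bot]
  refine Eq.trans ?_ (h.trans (by norm_num))
  rfl

theorem IsPlaneReflection.planeReflection {v : E3} (hv : v ≠ 0) :
    IsPlaneReflection (planeReflection v) := ⟨v, hv, rfl⟩

theorem IsPlaneReflection.detO_eq {g : O3} (hg : IsPlaneReflection g) : detO g = -1 := by
  obtain ⟨v, hv, rfl⟩ := hg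
  exact detO_planeReflection hv

theorem IsPlaneReflection.mul_self {g : O3} (hg : IsPlaneReflection g) : g * g = 1 := by
  obtain ⟨v, hv, rfl⟩ := hg
  exact planeReflection_mul_self v

theorem detO_planeReflection_eq (v : E3) :
    detO (planeReflection v) = 1 ∨ detO (planeReflection v) = -1 := by
  rcases eq_or_ne v 0 with rfl | h
  · rw [planeReflection_zero, map_one]; exact Or.inl rfl
  · exact Or.inr (detO_planeReflection h)

theorem detO_eq_one_or_neg_one (g : O3) : detO g = 1 ∨ detO g = -1 := by
  obtain ⟨l, -, rfl⟩ := g.reflections_generate_dim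
  induction l with
  | nil => left; simp
  | cons v l ih =>
    rw [List.map_cons, List.prod_cons, map_mul]
    rcases detO_planeReflection_eq v with h | h <;> rcases ih with h' | h' <;>
      rw [planeReflection] at h <;> rw [h, h'] <;> norm_num

/-- An isometry fixing a subspace of codimension at most `n` is a product of at most `n`
reflections. -/
theorem exists_planeReflection_prod {g : O3} {K : Submodule ℝ E3} {n : ℕ}
    (hK : ∀ x ∈ K, g x = x) (hn : 3 ≤ finrank ℝ K + n) :
    ∃ l : List E3, l.length ≤ n ∧ g = (l.map planeReflection).prod := by
  apply g.reflections_generate_dim_aux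
  set F := (ContinuousLinearMap.id ℝ E3 - (g : E3 →L[ℝ] E3)).ker
  have hle : K ≤ F := by
    intro x hx
    simp [F, hK x hx, LinearMap.mem_ker]
  have h1 := Submodule.finrank_mono hle
  have h2 := Submodule.finrank_add_finrank_orthogonal F
  rw [finrank_euclideanSpace_fin] at h2
  omega

/-- A fixed line leaves room for at most two reflections in a factorization, and the determinant
makes their number odd. -/
theorem IsPlaneReflection.of_detO_of_apply_eq {g : O3} (hg : detO g = -1) {u : E3} (hu : u ≠ 0)
    (h : g u = u) : IsPlaneReflection g := by
  obtain ⟨l, hl, hgl⟩ := exists_planeReflection_prod (g := g) (K := Submodule.span ℝ {u}) (n := 2)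
    (by
      intro x hx
      obtain ⟨c, rfl⟩ := Submodule.mem_span_singleton.1 hx
      rw [map_smul, h]) (by rw [finrank_span_singleton hu])
  have key : ∀ v : E3, g = _root_.planeReflection v → IsPlaneReflection g := by
    rintro v rfl
    have : v ≠ 0 := by
      rintro rfl
      rw [planeReflection_zero, map_one] at hg
      norm_num at hg
    exact ⟨v, this, rfl⟩
  match l, hl, hgl with
  | [], _, h => simp [h] at hg; norm_num at hg
  | [v], _, h => exact key v (by simpa using h)
  | [v, w], _, h =>
    have h' : g = _root_.planeReflection v * _root_.planeReflection w := by simpa using h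
    rcases eq_or_ne v 0 with rfl | hv
    · exact key w (by rw [h', planeReflection_zero, one_mul])
    rcases eq_or_ne w 0 with rfl | hw
    · exact key v (by rw [h', planeReflection_zero, mul_one])
    rw [h', map_mul, detO_planeReflection hv, detO_planeReflection hw] at hg
    norm_num at hg

/-- Two independent fixed vectors would leave room for at most one reflection, and the determinant
excludes exactly one. -/
theorem exists_smul_eq_of_apply_eq {g : O3} (hg : detO g = 1) (h1 : g ≠ 1) {u w : E3} (hu : u ≠ 0)
    (hgu : g u = u) (hgw : g w = w) : ∃ c : ℝ, w = c • u := by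
  by_contra hc
  push Not at hc
  apply h1
  have hli : LinearIndependent ℝ ![u, w] := by
    rw [LinearIndependent.pair_iff' hu]
    exact fun a h => hc a h.symm
  obtain ⟨l, hl, hgl⟩ := exists_planeReflection_prod (g := g)
    (K := Submodule.span ℝ (Set.range ![u, w])) (n := 1)
    (by
      intro x hx
      refine Submodule.span_induction ?_ ?_ ?_ ?_ hx
      · rintro x ⟨i, rfl⟩
        fin_cases i
        · exact hgu
        · exact hgw
      · exact map_zero g
      · intro x y _ _ hx hy; rw [map_add, hx, hy]
      · intro a x _ hx; rw [map_smul, hx]) (by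
      rw [finrank_span_eq_card hli]; simp)
  match l, hl, hgl with
  | [], _, h => simpa using h
  | [v], _, h =>
    have h' : g = planeReflection v := by simpa using h
    rcases eq_or_ne v 0 with rfl | hv
    · rw [h', planeReflection_zero]
    rw [h', detO_planeReflection hv] at hg
    norm_num at hg

/-- A vector orthogonal to two given vectors. -/
theorem exists_ne_zero_inner_eq_zero (u w : E3) :
    ∃ v : E3, v ≠ 0 ∧ inner ℝ v u = 0 ∧ inner ℝ v w = 0 := by
  set K := Submodule.span ℝ (Set.range ![u, w])
  have h1 : finrank ℝ K ≤ 2 := by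
    have := finrank_range_le_card (R := ℝ) ![u, w]
    simpa [Set.finrank] using this
  have h2 := Submodule.finrank_add_finrank_orthogonal K
  rw [finrank_euclideanSpace_fin] at h2
  have h3 : Kᗮ ≠ ⊥ := by
    intro h
    rw [h, finrank_bot] at h2
    omega
  obtain ⟨v, hv, hv0⟩ := Submodule.exists_mem_ne_zero_of_ne_bot h3
  refine ⟨v, hv0, ?_, ?_⟩
  · exact (Submodule.mem_orthogonal' _ _).1 hv u (Submodule.subset_span ⟨0, rfl⟩)
  · exact (Submodule.mem_orthogonal' _ _).1 hv w (Submodule.subset_span ⟨1, rfl⟩)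

theorem exists_fixed_of_detO_eq_one {g : O3} (hg : detO g = 1) : ∃ u : E3, ‖u‖ = 1 ∧ g u = u := by
  suffices h : ∃ u : E3, u ≠ 0 ∧ g u = u by
    obtain ⟨u, hu, h⟩ := h
    exact ⟨‖u‖⁻¹ • u, norm_smul_inv_norm hu, by rw [map_smul, h]⟩
  -- Two planes through the origin share a line. Since `planeReflection 0 = 1`, zero vectors pad the
  -- shorter products; three genuine reflections contradict the determinant.
  have key : ∀ v w : E3, g = planeReflection v * planeReflection w → ∃ u : E3, u ≠ 0 ∧ g u = u := by
    rintro v w rfl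
    obtain ⟨u, hu, h1, h2⟩ := exists_ne_zero_inner_eq_zero v w
    refine ⟨u, hu, ?_⟩
    rw [real_inner_comm] at h1 h2
    rw [O3.mul_apply, planeReflection_apply_of_inner_eq_zero h2,
      planeReflection_apply_of_inner_eq_zero h1]
  obtain ⟨l, hl, hgl⟩ := g.reflections_generate_dim
  rw [finrank_euclideanSpace_fin] at hl
  change g = (l.map planeReflection).prod at hgl
  match l, hl, hgl with
  | [], _, h => exact key 0 0 (by simpa [planeReflection_zero] using h)
  | [v], _, h => exact key v 0 (by simpa [planeReflection_zero] using h)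
  | [v, w], _, h => exact key v w (by simpa using h)
  | [a, b, c], _, h =>
    have h' : g = planeReflection a * (planeReflection b * planeReflection c) := by simpa using h
    rcases eq_or_ne a 0 with rfl | ha
    · exact key b c (by rw [h', planeReflection_zero, one_mul])
    rcases eq_or_ne b 0 with rfl | hb
    · exact key a c (by rw [h', planeReflection_zero, one_mul])
    rcases eq_or_ne c 0 with rfl | hc
    · exact key a b (by rw [h', planeReflection_zero, mul_one])
    rw [h', map_mul, map_mul, detO_planeReflection ha, detO_planeReflection hb,
      detO_planeReflection hc] at hg
    norm_num at hg

/-! ### Axes -/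

/-- The group `G` preserves the line spanned by `u`. -/
def HasAxis (G : Subgroup O3) (u : E3) : Prop := ∀ g ∈ G, g u = u ∨ g u = -u

/-- The group `G` preserves some line through the origin. -/
def IsAxial (G : Subgroup O3) : Prop := ∃ u : E3, ‖u‖ = 1 ∧ HasAxis G u

theorem IsAxial.mono {G K : Subgroup O3} (h : G ≤ K) (hK : IsAxial K) : IsAxial G :=
  let ⟨u, hu, hK⟩ := hK
  ⟨u, hu, fun g hg => hK g (h hg)⟩

theorem ne_zero_of_norm_eq_one {u : E3} (hu : ‖u‖ = 1) : u ≠ 0 := by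
  rintro rfl
  simp at hu

theorem eq_or_eq_neg_of_eq_smul {u w : E3} (hu : ‖u‖ = 1) (hw : ‖w‖ = 1) {c : ℝ}
    (h : w = c • u) : w = u ∨ w = -u := by
  have hc : |c| = 1 := by
    rw [h, norm_smul, hu, mul_one, Real.norm_eq_abs] at hw
    exact hw
  rcases eq_or_eq_neg_of_abs_eq hc with rfl | rfl
  · left; simpa using h
  · right; simpa using h

theorem eq_or_eq_neg_of_fixed {g : O3} (hg : detO g = 1) (h1 : g ≠ 1) {u w : E3} (hu : ‖u‖ = 1)
    (hw : ‖w‖ = 1) (hgu : g u = u) (hgw : g w = w) : w = u ∨ w = -u := by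
  obtain ⟨c, hc⟩ := exists_smul_eq_of_apply_eq hg h1 (ne_zero_of_norm_eq_one hu) hgu hgw
  exact eq_or_eq_neg_of_eq_smul hu hw hc

/-- Unit vectors orthogonal to two independent vectors agree up to sign. -/
theorem eq_or_eq_neg_of_inner_eq_zero {u v w y : E3} (hu : ‖u‖ = 1) (hv : ‖v‖ = 1)
    (h1 : v ≠ u) (h2 : v ≠ -u) (hw : ‖w‖ = 1) (hy : ‖y‖ = 1)
    (hwu : inner ℝ w u = 0) (hwv : inner ℝ w v = 0) (hyu : inner ℝ y u = 0)
    (hyv : inner ℝ y v = 0) : y = w ∨ y = -w := by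
  have hli : LinearIndependent ℝ ![u, v] := by
    rw [LinearIndependent.pair_iff' (ne_zero_of_norm_eq_one hu)]
    intro a h
    rcases eq_or_eq_neg_of_eq_smul hu hv h.symm with h | h
    exacts [h1 h, h2 h]
  set K := Submodule.span ℝ (Set.range ![u, v])
  have hK : finrank ℝ K = 2 := by
    rw [finrank_span_eq_card hli]; simp
  have h3 := Submodule.finrank_add_finrank_orthogonal K
  rw [finrank_euclideanSpace_fin, hK] at h3
  have h4 : finrank ℝ Kᗮ = 1 := by omega
  have mem : ∀ x : E3, inner ℝ x u = 0 → inner ℝ x v = 0 → x ∈ Kᗮ := by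
    intro x hxu hxv
    rw [Submodule.mem_orthogonal']
    intro z hz
    refine Submodule.span_induction ?_ ?_ ?_ ?_ hz
    · rintro z ⟨i, rfl⟩
      fin_cases i
      · exact hxu
      · exact hxv
    · exact inner_zero_right x
    · intro a b _ _ ha hb; rw [inner_add_right, ha, hb, add_zero]
    · intro c a _ ha; rw [inner_smul_right, ha, mul_zero]
  have hw0 : (⟨w, mem w hwu hwv⟩ : Kᗮ) ≠ 0 := by
    intro h
    exact ne_zero_of_norm_eq_one hw (congrArg Subtype.val h)
  obtain ⟨c, hc⟩ := (finrank_eq_one_iff_of_nonzero' _ hw0).1 h4 ⟨y, mem y hyu hyv⟩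
  exact eq_or_eq_neg_of_eq_smul hw hy (c := c) (congrArg Subtype.val hc).symm

theorem exists_isPlaneReflection_fixing (u w : E3) :
    ∃ s : O3, IsPlaneReflection s ∧ s u = u ∧ s w = w := by
  obtain ⟨v, hv, h1, h2⟩ := exists_ne_zero_inner_eq_zero u w
  exact ⟨planeReflection v, .planeReflection hv, planeReflection_apply_of_inner_eq_zero h1,
    planeReflection_apply_of_inner_eq_zero h2⟩

theorem IsPlaneReflection.mul_of_apply_eq {s a : O3} (hs : IsPlaneReflection s) {u : E3}
    (hu : u ≠ 0) (hsu : s u = u) (ha : detO a = 1) (hau : a u = u) : IsPlaneReflection (s * a) := by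
  refine .of_detO_of_apply_eq ?_ hu ?_
  · rw [map_mul, hs.detO_eq, ha, mul_one]
  · rw [O3.mul_apply, hau, hsu]

theorem IsPlaneReflection.inv_eq {s : O3} (hs : IsPlaneReflection s) : s⁻¹ = s :=
  inv_eq_of_mul_eq_one_right hs.mul_self

/-- The product `s * a` is again a reflection, so `(s * a)² = 1`. -/
theorem IsPlaneReflection.conj_eq_inv {s a : O3} (hs : IsPlaneReflection s) {u : E3}
    (hu : u ≠ 0) (hsu : s u = u) (ha : detO a = 1) (hau : a u = u) : s * a * s⁻¹ = a⁻¹ := by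
  have h1 := (hs.mul_of_apply_eq hu hsu ha hau).mul_self
  rw [hs.inv_eq, eq_inv_iff_mul_eq_one]
  simpa [mul_assoc] using h1

theorem detO_inv (g : O3) : detO g⁻¹ = detO g := by
  have h : detO g * detO g⁻¹ = 1 := by rw [← map_mul, mul_inv_cancel, map_one]
  rcases detO_eq_one_or_neg_one g with h' | h' <;> rw [h'] at h ⊢ <;> linarith

/-- There is at most one half-turn about a given axis. -/
theorem eq_of_mul_self_eq_one {a b : O3} (ha : detO a = 1) (hb : detO b = 1) {u : E3}
    (hu : ‖u‖ = 1) (hau : a u = u) (hbu : b u = u) (ha2 : a * a = 1) (hb2 : b * b = 1)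
    (ha1 : a ≠ 1) (hb1 : b ≠ 1) : a = b := by
  have hu0 := ne_zero_of_norm_eq_one hu
  obtain ⟨w, hw0, hwu, -⟩ := exists_ne_zero_inner_eq_zero u u
  -- The vector `w + c w` is fixed by `c` yet orthogonal to its axis, hence zero. Then `b⁻¹ * a`
  -- fixes both `u` and `w`.
  have key : ∀ c : O3, detO c = 1 → c u = u → c * c = 1 → c ≠ 1 → c w = -w := by
    intro c hc hcu hc2 hc1
    have hfix : c (w + c w) = w + c w := by
      rw [map_add, ← O3.mul_apply, hc2, O3.one_apply, add_comm]
    obtain ⟨t, ht⟩ := exists_smul_eq_of_apply_eq hc hc1 hu0 hcu hfix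
    have h1 : inner ℝ (w + c w) u = 0 := by
      have h2 : inner ℝ (c w) (c u) = 0 := by rw [c.inner_map_map, hwu]
      rw [hcu] at h2
      rw [inner_add_left, hwu, h2, add_zero]
    rw [ht, inner_smul_left, real_inner_self_eq_norm_sq, hu] at h1
    have h2 : t = 0 := by simpa using h1
    rw [h2, zero_smul] at ht
    exact eq_neg_of_add_eq_zero_right ht
  by_contra hab
  have h1 : b⁻¹ * a ≠ 1 := fun h => hab (inv_mul_eq_one.1 h).symm
  have hd : detO (b⁻¹ * a) = 1 := by rw [map_mul, detO_inv, ha, hb, mul_one]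
  obtain ⟨t, ht⟩ := exists_smul_eq_of_apply_eq hd h1 hu0
    (w := w) (by rw [O3.mul_apply, hau, O3.inv_apply_eq, hbu])
    (by rw [O3.mul_apply, key a ha hau ha2 ha1, O3.inv_apply_eq, key b hb hbu hb2 hb1])
  rw [ht, inner_smul_left, real_inner_self_eq_norm_sq, hu] at hwu
  have h2 : t = 0 := by simpa using hwu
  rw [h2, zero_smul] at ht
  exact hw0 ht

/-- A group preserves a line as soon as its rotation subgroup does. -/
theorem IsAxial.of_inf_ker {G : Subgroup O3} (h : IsAxial (G ⊓ detO.ker)) : IsAxial G := by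
  obtain ⟨u, hu, hH⟩ := h
  by_cases hG : ∀ g ∈ G, detO g = 1
  · exact ⟨u, hu, fun g hg => hH g ⟨hg, hG g hg⟩⟩
  push Not at hG
  obtain ⟨g, hg, hg1⟩ := hG
  have hgd : detO g = -1 := (detO_eq_one_or_neg_one g).resolve_left hg1
  have hv : ‖g u‖ = 1 := by rw [g.norm_map, hu]
  have hHv : ∀ h ∈ G ⊓ detO.ker, h (g u) = g u ∨ h (g u) = -g u := by
    rintro h ⟨hh, hd⟩
    have hd' : detO h = 1 := hd
    have hmem : g⁻¹ * h * g ∈ G ⊓ detO.ker := by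
      refine ⟨G.mul_mem (G.mul_mem (G.inv_mem hg) hh) hg, ?_⟩
      change detO (g⁻¹ * h * g) = 1
      rw [map_mul, map_mul, detO_inv, hd', hgd]
      norm_num
    have hx : h (g u) = g ((g⁻¹ * h * g) u) := by
      rw [← O3.mul_apply, ← O3.mul_apply]
      congr 1
      group
    rw [hx]
    rcases hH _ hmem with h | h <;> rw [h]
    · exact Or.inl rfl
    · exact Or.inr (map_neg g u)
  -- The rotations have index two, so every other element of `G` is a rotation in `G` times `g`.
  have hred : ∀ w : E3, (∀ h ∈ G ⊓ detO.ker, h w = w ∨ h w = -w) → (g w = w ∨ g w = -w) →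
      HasAxis G w := by
    intro w h1 h2 x hx
    rcases detO_eq_one_or_neg_one x with hd | hd
    · exact h1 x ⟨hx, hd⟩
    · have hmem : x * g⁻¹ ∈ G ⊓ detO.ker := by
        refine ⟨G.mul_mem hx (G.inv_mem hg), ?_⟩
        change detO (x * g⁻¹) = 1
        rw [map_mul, detO_inv, hd, hgd]
        norm_num
      have hx : x w = (x * g⁻¹) (g w) := by
        rw [← O3.mul_apply]
        congr 1
        group
      rw [hx]
      rcases h2 with h2 | h2 <;> rcases h1 _ hmem with h3 | h3 <;> rw [h2] <;>
        simp only [map_neg, h3, neg_neg, true_or, or_true]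
  by_cases h1 : g u = u ∨ g u = -u
  · exact ⟨u, hu, hred u hH h1⟩
  push Not at h1
  -- The lines through `u` and `g u` are both preserved by the rotations and, since `g * g` is one,
  -- exchanged by `g`. Their common normal is therefore an axis of `G`.
  obtain ⟨w, hw0, hwu, hwv⟩ := exists_ne_zero_inner_eq_zero u (g u)
  wlog hw : ‖w‖ = 1 generalizing w
  · refine this (‖w‖⁻¹ • w) ?_ ?_ ?_ (norm_smul_inv_norm hw0)
    · exact smul_ne_zero (inv_ne_zero (norm_ne_zero_iff.2 hw0)) hw0
    · rw [inner_smul_left, hwu, mul_zero]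
    · rw [inner_smul_left, hwv, mul_zero]
  have hline : ∀ x : O3, inner ℝ (x w) u = 0 → inner ℝ (x w) (g u) = 0 → x w = w ∨ x w = -w :=
    fun x h3 h4 => eq_or_eq_neg_of_inner_eq_zero hu hv h1.1 h1.2 hw (by rw [x.norm_map, hw])
      hwu hwv h3 h4
  have horth : ∀ (x : O3) (p q : E3), inner ℝ w p = 0 → (x p = q ∨ x p = -q) →
      inner ℝ (x w) q = 0 := by
    rintro x p q hp (h | h)
    · rw [← h, x.inner_map_map, hp]
    · have hq : q = -x p := by rw [h, neg_neg]
      rw [hq, inner_neg_right, x.inner_map_map, hp, neg_zero]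
  refine ⟨w, hw, hred w ?_ ?_⟩
  · intro h hh
    exact hline h (horth h u u hwu (hH h hh)) (horth h _ _ hwv (hHv h hh))
  · refine hline g (horth g (g u) u hwv ?_) (horth g u (g u) hwu (Or.inl rfl))
    have : g * g ∈ G ⊓ detO.ker := by
      refine ⟨G.mul_mem hg hg, ?_⟩
      change detO (g * g) = 1
      rw [map_mul, hgd]
      norm_num
    exact hH _ this

/-! ### Groups generated by two rotations -/

/-- The reflection `s` normalizes `H` and generates a reflection group together with it. -/
structure IsMirror (H : Subgroup O3) (s : O3) : Prop where
  isPlaneReflection : IsPlaneReflection s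
  conj_mem : ∀ h ∈ H, s * h * s⁻¹ ∈ H
  isReflectionGroup : IsReflectionGroup (H ⊔ Subgroup.zpowers s)

/-- A reflection in a plane containing both axes inverts both generators, and `s`, `s * a`, `s * b`
are all reflections. -/
theorem exists_isMirror_closure_pair {a b : O3} (ha : detO a = 1) (hb : detO b = 1) {u w : E3}
    (hu : u ≠ 0) (hw : w ≠ 0) (hau : a u = u) (hbw : b w = w) :
    ∃ s, IsMirror (Subgroup.closure {a, b}) s := by
  obtain ⟨s, hs, hsu, hsw⟩ := exists_isPlaneReflection_fixing u w
  have hmem : ∀ x ∈ ({a, b} : Set O3), x ∈ Subgroup.closure {a, b} :=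
    fun x hx => Subgroup.subset_closure hx
  refine ⟨s, hs, ?_, {s, s * a, s * b}, ?_, ?_⟩
  · intro h hh
    refine Subgroup.closure_induction (p := fun h _ => s * h * s⁻¹ ∈ Subgroup.closure {a, b})
      ?_ ?_ ?_ ?_ hh
    · rintro x (rfl | rfl)
      · rw [hs.conj_eq_inv hu hsu ha hau]
        exact inv_mem (hmem _ (Or.inl rfl))
      · rw [hs.conj_eq_inv hw hsw hb hbw]
        exact inv_mem (hmem _ (Or.inr rfl))
    · simp
    · intro x y _ _ hx hy
      have := mul_mem hx hy
      simpa [mul_assoc] using this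
    · intro x _ hx
      have := inv_mem hx
      simpa [mul_assoc] using this
  · rintro g (rfl | rfl | rfl)
    · exact hs
    · exact hs.mul_of_apply_eq hu hsu ha hau
    · exact hs.mul_of_apply_eq hw hsw hb hbw
  · have hs' : s ∈ Subgroup.closure {s, s * a, s * b} := Subgroup.subset_closure (Or.inl rfl)
    apply le_antisymm
    · refine sup_le ?_ (by rwa [Subgroup.zpowers_le])
      rw [Subgroup.closure_le]
      rintro x (rfl | rfl)
      · exact (Subgroup.mul_mem_cancel_left _ hs').1
          (Subgroup.subset_closure (Or.inr (Or.inl rfl)))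
      · exact (Subgroup.mul_mem_cancel_left _ hs').1
          (Subgroup.subset_closure (Or.inr (Or.inr rfl)))
    · rw [Subgroup.closure_le]
      have h1 : s ∈ Subgroup.closure {a, b} ⊔ Subgroup.zpowers s :=
        (le_sup_right : _ ≤ Subgroup.closure {a, b} ⊔ _) (Subgroup.mem_zpowers s)
      have h2 : ∀ x ∈ ({a, b} : Set O3), x ∈ Subgroup.closure {a, b} ⊔ Subgroup.zpowers s :=
        fun x hx => (le_sup_left : Subgroup.closure {a, b} ≤ _) (hmem x hx)
      rintro x (rfl | rfl | rfl)
      · exact h1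
      · exact mul_mem h1 (h2 _ (Or.inl rfl))
      · exact mul_mem h1 (h2 _ (Or.inr rfl))

/-! ### Counting poles of a finite rotation group -/

/-- The subgroup of `H` fixing the point `x`. -/
def pointStab (H : Subgroup O3) (x : E3) : Subgroup O3 where
  carrier := {g | g ∈ H ∧ g x = x}
  one_mem' := ⟨H.one_mem, rfl⟩
  mul_mem' := by
    rintro a b ⟨ha, ha'⟩ ⟨hb, hb'⟩
    exact ⟨H.mul_mem ha hb, by rw [O3.mul_apply, hb', ha']⟩
  inv_mem' := by
    rintro a ⟨ha, ha'⟩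
    exact ⟨H.inv_mem ha, by rw [O3.inv_apply_eq, ha']⟩

theorem pointStab_le (H : Subgroup O3) (x : E3) : pointStab H x ≤ H := fun _ h => h.1

theorem pointStab_mono {H K : Subgroup O3} (h : H ≤ K) (x : E3) : pointStab H x ≤ pointStab K x :=
  fun _ hg => ⟨h hg.1, hg.2⟩

/-- The unit vectors fixed by some nontrivial element of `H`. -/
def poleSet (H : Subgroup O3) : Set E3 := {x | ‖x‖ = 1 ∧ ∃ g ∈ H, g ≠ 1 ∧ g x = x}

theorem apply_mem_poleSet {H : Subgroup O3} {h : O3} (hh : h ∈ H) {x : E3} (hx : x ∈ poleSet H) :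
    h x ∈ poleSet H := by
  obtain ⟨hx, g, hg, hg1, hgx⟩ := hx
  refine ⟨by rw [h.norm_map, hx], h * g * h⁻¹, H.mul_mem (H.mul_mem hh hg) (H.inv_mem hh), ?_, ?_⟩
  · intro h'
    apply hg1
    rwa [mul_inv_eq_one, mul_eq_left] at h'
  · have : h⁻¹ (h x) = x := h.symm_apply_apply x
    rw [O3.mul_apply, O3.mul_apply, this, hgx]

noncomputable instance poleAction (H : Subgroup O3) : MulAction H (poleSet H) where
  smul h x := ⟨(h : O3) x, apply_mem_poleSet h.2 x.2⟩
  one_smul _ := rfl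
  mul_smul _ _ _ := rfl

theorem finite_poleSet {H : Subgroup O3} [Finite H] (hrot : ∀ h ∈ H, detO h = 1) :
    (poleSet H).Finite := by
  have hsub : poleSet H ⊆ ⋃ g ∈ {g : O3 | g ∈ H ∧ g ≠ 1}, {x : E3 | ‖x‖ = 1 ∧ g x = x} := by
    rintro x ⟨hx, g, hg, hg1, hgx⟩
    simp only [Set.mem_iUnion]
    exact ⟨g, ⟨hg, hg1⟩, hx, hgx⟩
  refine Set.Finite.subset (Set.Finite.biUnion ?_ ?_) hsub
  · exact (Set.toFinite (H : Set O3)).subset fun g hg => hg.1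
  · rintro g ⟨hg, hg1⟩
    obtain ⟨u, hu, hgu⟩ := exists_fixed_of_detO_eq_one (hrot g hg)
    refine (Set.toFinite {u, -u}).subset ?_
    rintro x ⟨hx, hgx⟩
    exact eq_or_eq_neg_of_fixed (hrot g hg) hg1 hu hx hgu hgx

theorem ne_neg_of_norm_eq_one {u : E3} (hu : ‖u‖ = 1) : u ≠ -u := by
  intro h
  have h2 : (2 : ℝ) • u = 0 := by rw [two_smul]; exact eq_neg_iff_add_eq_zero.1 h
  exact ne_zero_of_norm_eq_one hu ((smul_eq_zero.1 h2).resolve_left two_ne_zero)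

theorem card_fixedBy_pole {H : Subgroup O3} (hrot : ∀ h ∈ H, detO h = 1) {g : H} (hg : g ≠ 1) :
    Nat.card (MulAction.fixedBy (poleSet H) g) = 2 := by
  obtain ⟨u, hu, hgu⟩ := exists_fixed_of_detO_eq_one (hrot g g.2)
  have hg1 : (g : O3) ≠ 1 := fun h => hg (Subtype.ext h)
  have hgu' : (g : O3) (-u) = -u := by rw [map_neg, hgu]
  have h1 : u ∈ poleSet H := ⟨hu, g, g.2, hg1, hgu⟩
  have h2 : -u ∈ poleSet H := ⟨by rw [norm_neg, hu], g, g.2, hg1, hgu'⟩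
  have hset : MulAction.fixedBy (poleSet H) g = {⟨u, h1⟩, ⟨-u, h2⟩} := by
    ext x
    rw [MulAction.mem_fixedBy]
    constructor
    · intro hx
      rcases eq_or_eq_neg_of_fixed (hrot g g.2) hg1 hu x.2.1 hgu (congrArg Subtype.val hx) with h | h
      · exact Or.inl (Subtype.ext h)
      · exact Or.inr (Subtype.ext h)
    · rintro (rfl | rfl)
      · exact Subtype.ext hgu
      · exact Subtype.ext hgu'
  rw [Nat.card_coe_set_eq, hset, Set.ncard_pair]
  intro h
  exact ne_neg_of_norm_eq_one hu (congrArg Subtype.val h)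

theorem stabilizer_pole_eq {H : Subgroup O3} (x : poleSet H) :
    MulAction.stabilizer H x = (pointStab H x).subgroupOf H := by
  ext h
  rw [MulAction.mem_stabilizer_iff, Subgroup.mem_subgroupOf]
  exact ⟨fun hx => ⟨h.2, congrArg Subtype.val hx⟩, fun hx => Subtype.ext hx.2⟩

theorem card_stabilizer_pole {H : Subgroup O3} (x : poleSet H) :
    Nat.card (MulAction.stabilizer H x) = Nat.card (pointStab H x) := by
  rw [stabilizer_pole_eq]
  exact Nat.card_congr (Subgroup.subgroupOfEquivOfLe (pointStab_le H x)).toEquiv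

theorem card_orbit_mul_card_pointStab {H : Subgroup O3} (x : poleSet H) :
    Nat.card (MulAction.orbit H x) * Nat.card (pointStab H x) = Nat.card H := by
  rw [← card_stabilizer_pole, ← Nat.card_prod]
  exact Nat.card_congr (MulAction.orbitProdStabilizerEquivGroup H x)

theorem two_le_card_pointStab {H : Subgroup O3} [Finite H] (x : poleSet H) :
    2 ≤ Nat.card (pointStab H x) := by
  obtain ⟨hx, g, hg, hg1, hgx⟩ := x.2
  have : Finite (pointStab H (x : E3)) :=
    Finite.of_injective _ (Subgroup.inclusion_injective (pointStab_le H x))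
  have : Nontrivial (pointStab H (x : E3)) :=
    ⟨⟨g, hg, hgx⟩, 1, fun h => hg1 (congrArg Subtype.val h)⟩
  exact Finite.one_lt_card

/-- A pole whose orbit has at most two elements spans an axis. -/
theorem isAxial_of_card_orbit_le_two {H : Subgroup O3} [Finite H] (hrot : ∀ h ∈ H, detO h = 1)
    (x : poleSet H) (hx : Nat.card (MulAction.orbit H x) ≤ 2) : IsAxial H := by
  -- Index at most two makes the stabilizer normal, so a conjugate of the rotation `g` about `x`
  -- still fixes `x`; thus `g` fixes `h x` as well.
  have hnorm : (MulAction.stabilizer H x).Normal := by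
    have hi := MulAction.index_stabilizer H x
    rw [← Nat.card_coe_set_eq] at hi
    have h0 : (MulAction.stabilizer H x).index ≠ 0 := Subgroup.index_ne_zero_of_finite
    rw [← hi] at hx
    have h12 : (MulAction.stabilizer H x).index = 1 ∨ (MulAction.stabilizer H x).index = 2 := by
      omega
    rcases h12 with h | h
    · rw [Subgroup.index_eq_one.1 h]; infer_instance
    · exact Subgroup.normal_of_index_eq_two h
  obtain ⟨hx1, g, hg, hg1, hgx⟩ := x.2
  refine ⟨x, hx1, fun h hh => ?_⟩
  have hmem : (⟨g, hg⟩ : H) ∈ MulAction.stabilizer H x :=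
    MulAction.mem_stabilizer_iff.2 (Subtype.ext hgx)
  have h2 := hnorm.conj_mem _ hmem (⟨h, hh⟩⁻¹ : H)
  have h3 : h⁻¹ (g ((h⁻¹)⁻¹ x)) = x := congrArg Subtype.val (MulAction.mem_stabilizer_iff.1 h2)
  rw [inv_inv, O3.inv_apply_eq] at h3
  exact eq_or_eq_neg_of_fixed (hrot g hg) hg1 hx1 (by rw [h.norm_map, hx1]) hgx h3

/-- This is `1/a + 1/b + 1/c = 1 + 2/N` with denominators cleared. The condition `3 ≤ z` removes the
dihedral solution `a = b = 2`, where `z = 2`. -/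
theorem orbit_orders_of_le {N x y z a b c : ℕ} (hab : a ≤ b) (hbc : b ≤ c) (hx : x * a = N)
    (hy : y * b = N) (hz : z * c = N) (hz3 : 3 ≤ z) (ha : 2 ≤ a) (h : x + y + z = N + 2) :
    a = 2 ∧ b = 3 ∧ ((c = 3 ∧ N = 12) ∨ (c = 4 ∧ N = 24) ∨ (c = 5 ∧ N = 60)) := by
  have ha2 : a = 2 := by
    by_contra h'
    have h3 : 3 ≤ a := by omega
    have h1 : x * 3 ≤ N := hx ▸ Nat.mul_le_mul_left x h3
    have h2 : y * 3 ≤ N := hy ▸ Nat.mul_le_mul_left y (h3.trans hab)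
    have h4 : z * 3 ≤ N := hz ▸ Nat.mul_le_mul_left z (h3.trans (hab.trans hbc))
    omega
  subst ha2
  have hb3 : b = 3 := by
    have hb2 : b ≠ 2 := by rintro rfl; omega
    by_contra h'
    have h3 : 4 ≤ b := by omega
    have h2 : y * 4 ≤ N := hy ▸ Nat.mul_le_mul_left y h3
    have h4 : z * 4 ≤ N := hz ▸ Nat.mul_le_mul_left z (h3.trans hbc)
    omega
  subst hb3
  refine ⟨rfl, rfl, ?_⟩
  have hc : c < 6 := by
    by_contra h'
    have h4 : z * 6 ≤ N := hz ▸ Nat.mul_le_mul_left z (by omega)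
    omega
  interval_cases c <;> omega

/-- The arithmetic of the orbits of poles. -/
theorem orbit_orders {N x y z a b c : ℕ} (hx : x * a = N) (hy : y * b = N) (hz : z * c = N)
    (hx3 : 3 ≤ x) (hy3 : 3 ≤ y) (hz3 : 3 ≤ z) (ha : 2 ≤ a) (hb : 2 ≤ b) (hc : 2 ≤ c)
    (h : x + y + z = N + 2) :
    ∃ k, (k = a ∨ k = b ∨ k = c) ∧ ((k = 3 ∧ N = 12) ∨ (k = 4 ∧ N = 24) ∨ (k = 5 ∧ N = 60)) ∧
      (a = 2 ∨ a = 3 ∨ a = k) ∧ (b = 2 ∨ b = 3 ∨ b = k) ∧ (c = 2 ∨ c = 3 ∨ c = k) := by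
  rcases le_total a b with h1 | h1 <;> rcases le_total b c with h2 | h2 <;>
    rcases le_total a c with h3 | h3
  · have := orbit_orders_of_le h1 h2 hx hy hz hz3 ha h
    exact ⟨c, by omega⟩
  · have := orbit_orders_of_le h1 h2 hx hy hz hz3 ha h
    exact ⟨c, by omega⟩
  · have := orbit_orders_of_le h3 h2 hx hz hy hy3 ha (by omega)
    exact ⟨b, by omega⟩
  · have := orbit_orders_of_le h3 h1 hz hx hy hy3 hc (by omega)
    exact ⟨b, by omega⟩
  · have := orbit_orders_of_le h1 h3 hy hx hz hz3 hb (by omega)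
    exact ⟨c, by omega⟩
  · have := orbit_orders_of_le h2 h3 hy hz hx hx3 hb (by omega)
    exact ⟨a, by omega⟩
  · have := orbit_orders_of_le h2 h1 hz hy hx hx3 hc (by omega)
    exact ⟨a, by omega⟩
  · have := orbit_orders_of_le h2 h1 hz hy hx hx3 hc (by omega)
    exact ⟨a, by omega⟩

-- Burnside's count: the identity fixes all poles and every other rotation exactly two. The terms
-- are arranged to avoid subtraction of naturals.
open Classical in
theorem sum_card_orbit_pole {H : Subgroup O3} [Finite H] (hrot : ∀ h ∈ H, detO h = 1)
    [Fintype (MulAction.orbitRel.Quotient H (poleSet H))] :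
    ∑ ω : MulAction.orbitRel.Quotient H (poleSet H), Nat.card (MulAction.orbit H ω.out) +
      2 * Nat.card H =
    Fintype.card (MulAction.orbitRel.Quotient H (poleSet H)) * Nat.card H + 2 := by
  have : Finite (poleSet H) := finite_poleSet hrot
  have := Fintype.ofFinite H
  have := Fintype.ofFinite (poleSet H)
  have hB := MulAction.sum_card_fixedBy_eq_card_orbits_mul_card_group H (poleSet H)
  have h1 : Nat.card (poleSet H) =
      ∑ ω : MulAction.orbitRel.Quotient H (poleSet H), Nat.card (MulAction.orbit H ω.out) := by
    rw [Nat.card_congr (MulAction.selfEquivSigmaOrbits H (poleSet H)), Nat.card_sigma]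
  have h2 : ∑ g : H, Fintype.card (MulAction.fixedBy (poleSet H) g) =
      Nat.card (poleSet H) + (Nat.card H - 1) * 2 := by
    rw [← Finset.add_sum_erase _ _ (Finset.mem_univ (1 : H))]
    congr 1
    · rw [← Nat.card_eq_fintype_card, Nat.card_coe_set_eq]
      have : MulAction.fixedBy (poleSet H) (1 : H) = Set.univ := by
        ext x; simp
      rw [this, Set.ncard_univ]
    · rw [Finset.sum_congr rfl (g := fun _ => 2), Finset.sum_const,
        Finset.card_erase_of_mem (Finset.mem_univ _), Finset.card_univ, Nat.card_eq_fintype_card,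
        smul_eq_mul]
      intro g hg
      rw [← Nat.card_eq_fintype_card]
      exact card_fixedBy_pole hrot (Finset.ne_of_mem_erase hg)
  have h3 : 0 < Nat.card H := Nat.card_pos
  rw [h2, h1, ← Nat.card_eq_fintype_card (α := H)] at hB
  rw [← hB]
  omega

/-- The possible orders of a finite rotation group without axis, and of its point stabilizers. -/
theorem exists_pole_of_not_isAxial {H : Subgroup O3} [Finite H] (hrot : ∀ h ∈ H, detO h = 1)
    (hax : ¬ IsAxial H) :
    ∃ (k : ℕ) (p : E3), ‖p‖ = 1 ∧ Nat.card (pointStab H p) = k ∧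
      ((k = 3 ∧ Nat.card H = 12) ∨ (k = 4 ∧ Nat.card H = 24) ∨ (k = 5 ∧ Nat.card H = 60)) ∧
      ∀ q : E3, ‖q‖ = 1 → Nat.card (pointStab H q) = 1 ∨ Nat.card (pointStab H q) = 2 ∨
        Nat.card (pointStab H q) = 3 ∨ Nat.card (pointStab H q) = k := by
  classical
  have : Finite (poleSet H) := finite_poleSet hrot
  let Ω := MulAction.orbitRel.Quotient H (poleSet H)
  have := Fintype.ofFinite Ω
  have hsum : ∑ ω : Ω, Nat.card (MulAction.orbit H ω.out) + 2 * Nat.card H =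
      Fintype.card Ω * Nat.card H + 2 := sum_card_orbit_pole hrot
  have horb : ∀ x : poleSet H, 3 ≤ Nat.card (MulAction.orbit H x) := by
    intro x
    by_contra h
    exact hax (isAxial_of_card_orbit_le_two hrot x (by omega))
  have hN : 2 ≤ Nat.card H := by
    by_contra h
    have h0 : 0 < Nat.card H := Nat.card_pos
    have h1 : H = ⊥ := Subgroup.card_eq_one.1 (by omega)
    obtain ⟨u, hu⟩ := exists_norm_eq E3 zero_le_one
    refine hax ⟨u, hu, fun g hg => Or.inl ?_⟩
    rw [h1, Subgroup.mem_bot] at hg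
    rw [hg, O3.one_apply]
  -- Orbits of at most half the group order force fewer than four orbits; orbits of at least three
  -- poles force more than two.
  have hle : 2 * ∑ ω : Ω, Nat.card (MulAction.orbit H ω.out) ≤ Fintype.card Ω * Nat.card H := by
    rw [Finset.mul_sum]
    refine (Finset.sum_le_card_nsmul _ _ (Nat.card H) ?_).trans_eq ?_
    · intro ω _
      rw [← card_orbit_mul_card_pointStab ω.out, mul_comm]
      exact Nat.mul_le_mul_left _ (two_le_card_pointStab _)
    · rw [smul_eq_mul, Finset.card_univ]
  have hge : Fintype.card Ω * 3 ≤ ∑ ω : Ω, Nat.card (MulAction.orbit H ω.out) := by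
    rw [← smul_eq_mul, ← Finset.card_univ]
    exact Finset.card_nsmul_le_sum _ _ _ fun ω _ => horb _
  have hlt : Fintype.card Ω < 4 := by
    by_contra h
    have := Nat.mul_le_mul_right (Nat.card H) (not_lt.1 h)
    omega
  have h3 : Fintype.card Ω = 3 := by
    generalize hm : Fintype.card Ω = m at *
    interval_cases m <;> omega
  obtain ⟨α, β, γ, hαβ, hαγ, hβγ, huniv⟩ := Finset.card_eq_three.1 (Finset.card_univ.trans h3)
  rw [h3, huniv, Finset.sum_insert (by simp [hαβ, hαγ]), Finset.sum_pair hβγ] at hsum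
  obtain ⟨k, hk, hkN, ha, hb, hc⟩ := orbit_orders (card_orbit_mul_card_pointStab α.out)
    (card_orbit_mul_card_pointStab β.out) (card_orbit_mul_card_pointStab γ.out)
    (horb _) (horb _) (horb _) (two_le_card_pointStab _) (two_le_card_pointStab _)
    (two_le_card_pointStab _) (by omega)
  have hstab : ∀ (q : poleSet H) (ω : Ω), Quotient.mk'' q = ω →
      Nat.card (pointStab H (q : E3)) = Nat.card (pointStab H (ω.out : E3)) := by
    intro q ω h
    have h1 : MulAction.orbit H q = MulAction.orbit H ω.out := by
      rw [MulAction.orbit_eq_iff]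
      exact Quotient.exact (h.trans ω.out_eq.symm)
    have h2 := card_orbit_mul_card_pointStab q
    rw [h1, ← card_orbit_mul_card_pointStab ω.out] at h2
    exact Nat.eq_of_mul_eq_mul_left (by have := horb ω.out; omega) h2
  have hq : ∀ q : E3, ‖q‖ = 1 → Nat.card (pointStab H q) = 1 ∨ Nat.card (pointStab H q) = 2 ∨
        Nat.card (pointStab H q) = 3 ∨ Nat.card (pointStab H q) = k := by
    intro q hq
    by_cases hp : q ∈ poleSet H
    · right
      have hmem : (Quotient.mk'' (⟨q, hp⟩ : poleSet H) : Ω) ∈ ({α, β, γ} : Finset Ω) := by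
        rw [← huniv]; exact Finset.mem_univ _
      simp only [Finset.mem_insert, Finset.mem_singleton] at hmem
      rcases hmem with h | h | h
      · have := hstab _ _ h; simp only at this; omega
      · have := hstab _ _ h; simp only at this; omega
      · have := hstab _ _ h; simp only at this; omega
    · left
      rw [Subgroup.card_eq_one, Subgroup.eq_bot_iff_forall]
      rintro g ⟨hg, hgq⟩
      by_contra h1
      exact hp ⟨hq, g, hg, h1, hgq⟩
  rcases hk with h | h | h
  · exact ⟨k, α.out, α.out.2.1, h.symm, hkN, hq⟩
  · exact ⟨k, β.out, β.out.2.1, h.symm, hkN, hq⟩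
  · exact ⟨k, γ.out, γ.out.2.1, h.symm, hkN, hq⟩

/-! ### Groups without axis -/

theorem card_of_not_isAxial {H : Subgroup O3} [Finite H] (hrot : ∀ h ∈ H, detO h = 1)
    (hax : ¬ IsAxial H) : Nat.card H = 12 ∨ Nat.card H = 24 ∨ Nat.card H = 60 := by
  obtain ⟨k, p, -, -, h, -⟩ := exists_pole_of_not_isAxial hrot hax
  omega

theorem Subgroup.finite_of_le {Γ : Type*} [Group Γ] {H K : Subgroup Γ} [Finite K] (h : H ≤ K) :
    Finite H :=
  Finite.of_injective _ (Subgroup.inclusion_injective h)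

/-- There is at most one half-turn about `p`, so a stabilizer in which all squares are trivial has
at most two elements. -/
theorem exists_mul_self_ne_one {H : Subgroup O3} [Finite H] (hrot : ∀ h ∈ H, detO h = 1)
    {p : E3} (hp : ‖p‖ = 1) (h3 : 3 ≤ Nat.card (pointStab H p)) :
    ∃ a ∈ pointStab H p, a * a ≠ 1 := by
  by_contra! hc
  have : Finite (pointStab H p) := Subgroup.finite_of_le (pointStab_le H p)
  have hsub : ∃ b : O3, (pointStab H p : Set O3) ⊆ {1, b} := by
    by_cases hb : ∃ b ∈ pointStab H p, b ≠ 1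
    · obtain ⟨b, hb, hb1⟩ := hb
      refine ⟨b, fun a ha => ?_⟩
      by_cases ha1 : a = 1
      · exact Or.inl ha1
      · exact Or.inr (eq_of_mul_self_eq_one (hrot a ha.1) (hrot b hb.1) hp ha.2 hb.2
          (hc a ha) (hc b hb) ha1 hb1)
    · push Not at hb
      exact ⟨1, fun a ha => Or.inl (hb a ha)⟩
  obtain ⟨b, hb⟩ := hsub
  have h1 := Set.ncard_le_ncard hb (Set.toFinite _)
  have h2 := Set.ncard_insert_le (1 : O3) {b}
  rw [Set.ncard_singleton] at h2
  have h4 : Nat.card (pointStab H p) = (pointStab H p : Set O3).ncard := Nat.card_coe_set_eq _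
  omega

theorem eq_or_eq_neg_of_line {a : O3} (ha : detO a = 1) (ha2 : a * a ≠ 1) {p u : E3}
    (hp : ‖p‖ = 1) (hu : ‖u‖ = 1) (hap : a p = p) (hau : a u = u ∨ a u = -u) :
    u = p ∨ u = -p := by
  refine eq_or_eq_neg_of_fixed (g := a * a) (by rw [map_mul, ha, mul_one]) ha2 hp hu ?_ ?_
  · rw [O3.mul_apply, hap, hap]
  · rcases hau with h | h
    · rw [O3.mul_apply, h, h]
    · rw [O3.mul_apply, h, map_neg, h, neg_neg]

/-- A finite rotation group without axis is generated by two rotations, hence has a mirror. -/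
theorem exists_isMirror_of_not_isAxial {H : Subgroup O3} [Finite H] (hrot : ∀ h ∈ H, detO h = 1)
    (hax : ¬ IsAxial H) : ∃ s, IsMirror H s := by
  obtain ⟨k, p, hp, hpk, hk, -⟩ := exists_pole_of_not_isAxial hrot hax
  obtain ⟨a, ha, ha2⟩ := exists_mul_self_ne_one hrot hp (by omega)
  have hh : ∃ h ∈ H, h p ≠ p ∧ h p ≠ -p := by
    by_contra! hc
    refine hax ⟨p, hp, fun h hh => ?_⟩
    by_cases h1 : h p = p
    · exact Or.inl h1
    · exact Or.inr (hc h hh h1)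
  obtain ⟨h, hh, h1, h2⟩ := hh
  -- The conjugate rotates about `h p`, a different axis. Neither `a` nor `b` is a half-turn, so
  -- each preserves no line in its own axis direction but that axis, and an invariant line of both
  -- would have to be both axes.
  set b := h * a * h⁻¹
  have hbH : b ∈ H := H.mul_mem (H.mul_mem hh ha.1) (H.inv_mem hh)
  have hbp : b (h p) = h p := by
    have : h⁻¹ (h p) = p := h.symm_apply_apply p
    rw [O3.mul_apply, O3.mul_apply, this, ha.2]
  have hb2 : b * b ≠ 1 := by
    intro hb
    apply ha2
    have h3 : b * b = h * (a * a) * h⁻¹ := by simp [b, mul_assoc]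
    rwa [h3, mul_inv_eq_one, mul_eq_left] at hb
  have hhp : ‖h p‖ = 1 := by rw [h.norm_map, hp]
  set K := Subgroup.closure {a, b}
  have haK : a ∈ K := Subgroup.subset_closure (Or.inl rfl)
  have hbK : b ∈ K := Subgroup.subset_closure (Or.inr rfl)
  have hKH : K ≤ H := by
    rw [Subgroup.closure_le]
    rintro x (rfl | rfl)
    exacts [ha.1, hbH]
  have hKax : ¬ IsAxial K := by
    rintro ⟨u, hu, hK⟩
    have h3 := eq_or_eq_neg_of_line (hrot a ha.1) ha2 hp hu ha.2 (hK a haK)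
    have h4 := eq_or_eq_neg_of_line (hrot b hbH) hb2 hhp hu hbp (hK b hbK)
    rcases h3 with h3 | h3 <;> rcases h4 with h4 | h4 <;> rw [h3] at h4
    · exact h1 h4.symm
    · exact h2 (neg_eq_iff_eq_neg.2 h4).symm
    · exact h2 h4.symm
    · exact h1 (neg_injective h4).symm
  have : Finite K := Subgroup.finite_of_le hKH
  have hKrot : ∀ h ∈ K, detO h = 1 := fun h hh => hrot h (hKH hh)
  obtain ⟨k', p', -, -, hk', hq⟩ := exists_pole_of_not_isAxial hKrot hKax
  have hdvd : Nat.card (pointStab K p) ∣ k := hpk ▸ Subgroup.card_dvd_of_le (pointStab_mono hKH p)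
  have hpow : ∀ m, Nat.card (pointStab K p) = m → a ^ m = 1 := by
    rintro m rfl
    exact congrArg Subtype.val (pow_card_eq_one' (x := (⟨a, haK, ha.2⟩ : pointStab K p)))
  have hne1 : Nat.card (pointStab K p) ≠ 1 := by
    intro h
    have := hpow 1 h
    rw [pow_one] at this
    rw [this] at ha2
    simp at ha2
  have hne2 : Nat.card (pointStab K p) ≠ 2 := by
    intro h
    have := hpow 2 h
    rw [pow_two] at this
    exact ha2 this
  -- The order divides `k`, one of 3, 4, 5, and is neither 1 nor 2. For `k = 4` or `5` this forces
  -- `k' = k` and `K` has the order of `H`; for `k = 3`, `H` already has the least possible order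
  -- 12.
  have hst : Nat.card (pointStab K p) = k := by
    generalize Nat.card (pointStab K p) = m at *
    have hm := Nat.le_of_dvd (by omega) hdvd
    rcases hk with ⟨rfl, -⟩ | ⟨rfl, -⟩ | ⟨rfl, -⟩ <;> interval_cases m <;> omega
  have hqp := hq p hp
  have hKeq : K = H := Subgroup.eq_of_le_of_card_ge hKH (by omega)
  rw [← hKeq]
  exact exists_isMirror_closure_pair (hrot a ha.1) (hrot b hbH) (ne_zero_of_norm_eq_one hp)
    (ne_zero_of_norm_eq_one hhp) ha.2 hbp

/-! ### Central inversion and groups with improper elements. -/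

/-- The central inversion. -/
noncomputable def negO : O3 := LinearIsometryEquiv.neg ℝ

theorem negO_apply (x : E3) : negO x = -x := rfl

theorem negO_mul_self : negO * negO = 1 := by
  ext1 x
  rw [O3.mul_apply, negO_apply, negO_apply, neg_neg, O3.one_apply]

theorem mul_negO (g : O3) : g * negO = negO * g := by
  ext1 x
  rw [O3.mul_apply, O3.mul_apply, negO_apply, negO_apply, map_neg]

theorem negO_mul_cancel (g : O3) : negO * (negO * g) = g := by
  rw [← mul_assoc, negO_mul_self, one_mul]

theorem negO_mul_mul_self (g : O3) : negO * g * (negO * g) = g * g := by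
  rw [mul_assoc, ← mul_assoc g, mul_negO, mul_assoc, negO_mul_cancel]

theorem negO_mul_conj (g h : O3) : negO * g * h * (negO * g)⁻¹ = g * h * g⁻¹ := by
  have h1 : negO⁻¹ = negO := inv_eq_of_mul_eq_one_right negO_mul_self
  rw [mul_inv_rev, h1, ← mul_assoc, mul_negO]
  simp only [mul_assoc]
  rw [negO_mul_cancel]

theorem detO_negO_mul {g : O3} (hg : detO g = -1) : detO (negO * g) = 1 := by
  rw [map_mul, hg, negO, detO_neg]
  norm_num

theorem sup_zpowers_eq_sup_zpowers_negO {H : Subgroup O3} {g : O3} (h : negO * g ∈ H) :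
    H ⊔ Subgroup.zpowers g = H ⊔ Subgroup.zpowers negO := by
  have h1 : ∀ x, H ≤ H ⊔ Subgroup.zpowers x := fun x => le_sup_left
  have h2 : ∀ x, x ∈ H ⊔ Subgroup.zpowers x :=
    fun x => (le_sup_right : _ ≤ H ⊔ Subgroup.zpowers x) (Subgroup.mem_zpowers x)
  apply le_antisymm <;> refine sup_le le_sup_left ?_ <;> rw [Subgroup.zpowers_le]
  · rw [← negO_mul_cancel g]
    exact mul_mem (h2 _) (h1 _ h)
  · exact (Subgroup.mul_mem_cancel_right _ (h2 g)).1 (h1 _ h)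

theorem detO_eq_one_of_mem_sup_zpowers {H : Subgroup O3} (hrot : ∀ h ∈ H, detO h = 1) {t : O3}
    (ht : detO t = 1) : ∀ h ∈ H ⊔ Subgroup.zpowers t, detO h = 1 := by
  have : H ⊔ Subgroup.zpowers t ≤ detO.ker := by
    refine sup_le (fun h hh => hrot h hh) ?_
    rw [Subgroup.zpowers_le]
    exact ht
  exact fun h hh => this hh

/-- A rotation group without axis extends with index two only from order `12` to order `24`. -/
theorem card_sup_zpowers_of_not_isAxial {H : Subgroup O3} [Finite H] (hrot : ∀ h ∈ H, detO h = 1)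
    (hax : ¬ IsAxial H) {t : O3} (hdet : detO t = 1) (ht : t * t ∈ H)
    (hn : ∀ h ∈ H, t * h * t⁻¹ ∈ H) (htH : t ∉ H) :
    Nat.card H = 12 ∧ Nat.card (H ⊔ Subgroup.zpowers t : Subgroup O3) = 24 := by
  have := Subgroup.finite_sup_zpowers_of_sq_mem ht hn
  have h1 := card_of_not_isAxial hrot hax
  have h2 := card_of_not_isAxial (detO_eq_one_of_mem_sup_zpowers hrot hdet)
    (fun h => hax (h.mono le_sup_left))
  have h3 := Subgroup.card_sup_zpowers_of_sq_mem ht hn htH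
  omega

/-- For a mirror `s`, the rotation `-s` normalizes `K` and squares to 1. Outside `K` it would double
`K`, which is possible only from order 12; inside `K`, adjoining `-1` is the same as adjoining `s`.
-/
theorem isReflectionGroup_sup_zpowers_negO {K : Subgroup O3} [Finite K]
    (hrot : ∀ h ∈ K, detO h = 1) (hax : ¬ IsAxial K) (h12 : Nat.card K ≠ 12) :
    IsReflectionGroup (K ⊔ Subgroup.zpowers negO) := by
  obtain ⟨s, hs⟩ := exists_isMirror_of_not_isAxial hrot hax
  have hmem : negO * s ∈ K := by
    by_contra h
    refine h12 (card_sup_zpowers_of_not_isAxial hrot hax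
      (detO_negO_mul hs.isPlaneReflection.detO_eq) ?_ ?_ h).1
    · rw [negO_mul_mul_self, hs.isPlaneReflection.mul_self]
      exact K.one_mem
    · intro h hh
      rw [negO_mul_conj]
      exact hs.conj_mem h hh
  rw [← sup_zpowers_eq_sup_zpowers_negO hmem]
  exact hs.isReflectionGroup

theorem negO_not_mem {K : Subgroup O3} (hrot : ∀ h ∈ K, detO h = 1) : negO ∉ K := by
  intro h
  have h1 := hrot _ h
  rw [negO, detO_neg] at h1
  norm_num at h1

theorem negO_conj_mem {K : Subgroup O3} : ∀ h ∈ K, negO * h * negO⁻¹ ∈ K := by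
  intro h hh
  rwa [← mul_negO, mul_inv_cancel_right]

theorem inf_ker_sup_zpowers {G : Subgroup O3} {g : O3} (hg : g ∈ G) (hd : detO g = -1) :
    G = G ⊓ detO.ker ⊔ Subgroup.zpowers g := by
  apply le_antisymm
  · intro x hx
    have h1 : g ∈ G ⊓ detO.ker ⊔ Subgroup.zpowers g :=
      (le_sup_right : _ ≤ G ⊓ detO.ker ⊔ Subgroup.zpowers g) (Subgroup.mem_zpowers g)
    have h2 : G ⊓ detO.ker ≤ G ⊓ detO.ker ⊔ Subgroup.zpowers g := le_sup_left
    rcases detO_eq_one_or_neg_one x with h | h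
    · exact h2 ⟨hx, h⟩
    · refine (Subgroup.mul_mem_cancel_left _ h1).1 (h2 ⟨G.mul_mem hg hx, ?_⟩)
      change detO (g * x) = 1
      rw [map_mul, hd, h]
      norm_num
  · refine sup_le inf_le_left ?_
    rwa [Subgroup.zpowers_le]

theorem exists_reflectionGroup_of_not_isAxial {G : Subgroup O3} [Finite G] (hG : ¬ IsAxial G) :
    ∃ G' : Subgroup O3, G ≤ G' ∧ Finite G' ∧ IsReflectionGroup G' ∧ G.relIndex G' ≤ 2 := by
  by_cases hrot : ∀ g ∈ G, detO g = 1
  · obtain ⟨s, hs⟩ := exists_isMirror_of_not_isAxial hrot hG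
    have hss : s * s ∈ G := by rw [hs.isPlaneReflection.mul_self]; exact G.one_mem
    exact ⟨_, le_sup_left, Subgroup.finite_sup_zpowers_of_sq_mem hss hs.conj_mem,
      hs.isReflectionGroup, Subgroup.relIndex_sup_zpowers_le_two hss hs.conj_mem⟩
  push Not at hrot
  obtain ⟨g, hg, hg1⟩ := hrot
  have hgd : detO g = -1 := (detO_eq_one_or_neg_one g).resolve_left hg1
  have hGeq := inf_ker_sup_zpowers hg hgd
  have hHG : G ⊓ detO.ker ≤ G := inf_le_left
  have hH : ¬ IsAxial (G ⊓ detO.ker) := fun h => hG h.of_inf_ker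
  have hHrot : ∀ h ∈ G ⊓ detO.ker, detO h = 1 := fun h hh => hh.2
  have hgH : g ∉ G ⊓ detO.ker := fun h => hg1 h.2
  have hgg : g * g ∈ G ⊓ detO.ker := by
    refine ⟨G.mul_mem hg hg, ?_⟩
    change detO (g * g) = 1
    rw [map_mul, hgd]
    norm_num
  have hgn : ∀ h ∈ G ⊓ detO.ker, g * h * g⁻¹ ∈ G ⊓ detO.ker := by
    rintro h ⟨hh, hd⟩
    refine ⟨G.mul_mem (G.mul_mem hg hh) (G.inv_mem hg), ?_⟩
    have hd' : detO h = 1 := hd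
    change detO (g * h * g⁻¹) = 1
    rw [map_mul, map_mul, detO_inv, hgd, hd']
    norm_num
  generalize G ⊓ detO.ker = H at *
  have : Finite H := Subgroup.finite_of_le hHG
  have hcardG : Nat.card G = Nat.card H * 2 := by
    conv_lhs => rw [hGeq]
    exact Subgroup.card_sup_zpowers_of_sq_mem hgg hgn hgH
  set t := negO * g with ht
  have htd : detO t = 1 := detO_negO_mul hgd
  have htt : t * t ∈ H := by rwa [ht, negO_mul_mul_self]
  have htn : ∀ h ∈ H, t * h * t⁻¹ ∈ H := by
    intro h hh
    rw [ht, negO_mul_conj]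
    exact hgn h hh
  -- Adjoining `-1` to `K` recovers `g` from `t`, and the resulting order `2|K| ≤ 4|H| = 2|G|`
  -- bounds the index by 2.
  have key : ∀ K : Subgroup O3, Finite K → (∀ h ∈ K, detO h = 1) → H ≤ K → t ∈ K →
      Nat.card K ≠ 12 → Nat.card K ≤ 2 * Nat.card H →
      ∃ G' : Subgroup O3, G ≤ G' ∧ Finite G' ∧ IsReflectionGroup G' ∧ G.relIndex G' ≤ 2 := by
    intro K hfin hrot hHK htK h12 hcard
    have hnn : negO * negO ∈ K := by rw [negO_mul_self]; exact K.one_mem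
    have hle : G ≤ K ⊔ Subgroup.zpowers negO := by
      rw [← sup_zpowers_eq_sup_zpowers_negO htK, hGeq]
      exact sup_le_sup_right hHK _
    refine ⟨_, hle, Subgroup.finite_sup_zpowers_of_sq_mem hnn negO_conj_mem,
      isReflectionGroup_sup_zpowers_negO hrot (fun h => hH (h.mono hHK)) h12, ?_⟩
    have h1 := Subgroup.card_mul_relIndex_eq hle
    rw [Subgroup.card_sup_zpowers_of_sq_mem hnn negO_conj_mem (negO_not_mem hrot)] at h1
    have h2 : 0 < Nat.card G := Nat.card_pos
    refine Nat.le_of_mul_le_mul_left ?_ h2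
    omega
  have hpos : 0 < Nat.card H := Nat.card_pos
  by_cases htH : t ∈ H
  -- Order 12 is the one case where `H` itself may not serve as `K`: adjoining `-s` raises it to 24,
  -- unless `-s ∈ H` and `G` is already generated by reflections.
  · by_cases h12 : Nat.card H = 12
    · obtain ⟨s, hs⟩ := exists_isMirror_of_not_isAxial hHrot hH
      by_cases hsH : negO * s ∈ H
      · refine ⟨G, le_rfl, inferInstance, ?_, by rw [Subgroup.relIndex_self]; norm_num⟩
        rw [hGeq, sup_zpowers_eq_sup_zpowers_negO htH, ← sup_zpowers_eq_sup_zpowers_negO hsH]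
        exact hs.isReflectionGroup
      · have hsd := detO_negO_mul hs.isPlaneReflection.detO_eq
        have hss : negO * s * (negO * s) ∈ H := by
          rw [negO_mul_mul_self, hs.isPlaneReflection.mul_self]
          exact H.one_mem
        have hsn : ∀ h ∈ H, negO * s * h * (negO * s)⁻¹ ∈ H := by
          intro h hh
          rw [negO_mul_conj]
          exact hs.conj_mem h hh
        have hc := card_sup_zpowers_of_not_isAxial hHrot hH hsd hss hsn hsH
        exact key _ (Subgroup.finite_sup_zpowers_of_sq_mem hss hsn)
          (detO_eq_one_of_mem_sup_zpowers hHrot hsd) le_sup_left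
          ((le_sup_left : H ≤ H ⊔ _) htH) (by omega) (by omega)
    · exact key H inferInstance hHrot le_rfl htH h12 (by omega)
  · have hc := card_sup_zpowers_of_not_isAxial hHrot hH htd htt htn htH
    exact key _ (Subgroup.finite_sup_zpowers_of_sq_mem htt htn)
      (detO_eq_one_of_mem_sup_zpowers hHrot htd) le_sup_left
      ((le_sup_right : _ ≤ H ⊔ Subgroup.zpowers t) (Subgroup.mem_zpowers t)) (by omega) (by omega)

/-! ### Groups with an axis -/

theorem planeReflection_apply {u : E3} (hu : ‖u‖ = 1) (x : E3) :
    planeReflection u x = x - (2 * inner ℝ u x) • u := by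
  rw [planeReflection, Submodule.reflection_orthogonal_apply, Submodule.reflection_singleton_apply,
    hu]
  simp [two_smul, two_mul, add_smul]

theorem planeReflection_comm {u : E3} (hu : ‖u‖ = 1) {g : O3} (hg : g u = u ∨ g u = -u) :
    g * planeReflection u = planeReflection u * g := by
  ext1 x
  rw [O3.mul_apply, O3.mul_apply, planeReflection_apply hu, planeReflection_apply hu, map_sub,
    map_smul]
  have h := g.inner_map_map u x
  rcases hg with hg | hg <;> rw [hg] at h ⊢
  · rw [h]
  · rw [← h, inner_neg_left]
    simp

theorem planeReflection_mul_cancel (u : E3) (g : O3) :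
    planeReflection u * (planeReflection u * g) = g := by
  rw [← mul_assoc, planeReflection_mul_self, one_mul]

theorem planeReflection_conj {u : E3} (hu : ‖u‖ = 1) {g : O3} (hg : g u = u ∨ g u = -u) :
    planeReflection u * g * (planeReflection u)⁻¹ = g := by
  rw [← planeReflection_comm hu hg, mul_inv_cancel_right]

/-- The product of the two reflections has determinant 1 and fixes `u` and a vector orthogonal to
`u`, so it is trivial. -/
theorem IsPlaneReflection.eq_planeReflection {g : O3} (hg : IsPlaneReflection g) {u : E3}
    (hu : ‖u‖ = 1) (h : g u = -u) : g = _root_.planeReflection u := by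
  have hd : detO g = -1 := hg.detO_eq
  obtain ⟨v, hv, rfl⟩ := hg
  change _root_.planeReflection v = _
  have h' : _root_.planeReflection v u = -u := h
  have hd' : detO (_root_.planeReflection v) = -1 := hd
  obtain ⟨w, hw, hwv, hwu⟩ := exists_ne_zero_inner_eq_zero v u
  have hu0 := ne_zero_of_norm_eq_one hu
  have hvw : _root_.planeReflection v w = w :=
    planeReflection_apply_of_inner_eq_zero (by rw [real_inner_comm]; exact hwv)
  have h1 : _root_.planeReflection u * _root_.planeReflection v = 1 := by
    by_contra hne
    obtain ⟨c, hc⟩ := exists_smul_eq_of_apply_eq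
      (by rw [map_mul, hd', detO_planeReflection hu0]; norm_num) hne hu0 (w := w)
      (by rw [O3.mul_apply, h', map_neg, planeReflection_apply_self, neg_neg])
      (by rw [O3.mul_apply, hvw, planeReflection_apply_of_inner_eq_zero (v := u)
        (by rw [real_inner_comm]; exact hwu)])
    rw [hc, inner_smul_left, real_inner_self_eq_norm_sq, hu] at hwu
    have h2 : c = 0 := by simpa using hwu
    rw [h2, zero_smul] at hc
    exact hw hc
  rw [← planeReflection_mul_cancel u (_root_.planeReflection v), h1, mul_one]

/-- Improper elements fixing `u` are reflections, and a rotation `a` is the product of the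
reflections `s` and `s * a`. -/
theorem isReflectionGroup_of_fixed {A : Subgroup O3} {u : E3} (hu : u ≠ 0)
    (hA : ∀ a ∈ A, a u = u) {s : O3} (hs : s ∈ A) (hsd : detO s = -1) : IsReflectionGroup A := by
  refine ⟨{g | g ∈ A ∧ IsPlaneReflection g}, fun g hg => hg.2, le_antisymm ?_ ?_⟩
  · have hsr : IsPlaneReflection s := .of_detO_of_apply_eq hsd hu (hA s hs)
    have hsc : s ∈ Subgroup.closure {g | g ∈ A ∧ IsPlaneReflection g} :=
      Subgroup.subset_closure ⟨hs, hsr⟩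
    intro a ha
    rcases detO_eq_one_or_neg_one a with h | h
    · exact (Subgroup.mul_mem_cancel_left _ hsc).1 (Subgroup.subset_closure
        ⟨A.mul_mem hs ha, hsr.mul_of_apply_eq hu (hA s hs) h (hA a ha)⟩)
    · exact Subgroup.subset_closure ⟨ha, .of_detO_of_apply_eq h hu (hA a ha)⟩
  · rw [Subgroup.closure_le]
    exact fun g hg => hg.1

theorem IsReflectionGroup.sup_zpowers {A : Subgroup O3} (hA : IsReflectionGroup A) {s : O3}
    (hs : IsPlaneReflection s) : IsReflectionGroup (A ⊔ Subgroup.zpowers s) := by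
  obtain ⟨S, hS, rfl⟩ := hA
  refine ⟨S ∪ {s}, ?_, ?_⟩
  · rintro g (hg | rfl)
    exacts [hS g hg, hs]
  · rw [Subgroup.closure_union, Subgroup.zpowers_eq_closure]

/-- A group of rotations about the axis `u` and rotoreflections reversing it, containing some
rotoreflection but no reflection. -/
structure IsRotoreflectionGroup (G : Subgroup O3) (u : E3) : Prop where
  norm_eq : ‖u‖ = 1
  hasAxis : HasAxis G u
  detO_of_fixed : ∀ g ∈ G, g u = u → detO g = 1
  detO_of_reversed : ∀ g ∈ G, g u = -u → detO g = -1
  exists_reversing : ∃ g ∈ G, g u = -u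
  reflection_not_mem : planeReflection u ∉ G

theorem mem_of_mem_pointStab_sup {A : Subgroup O3} {u : E3} {s : O3} (hA : ∀ a ∈ A, a u = u)
    (hs : s u = u) : ∀ x ∈ A ⊔ Subgroup.zpowers s, x u = u := by
  have : A ⊔ Subgroup.zpowers s ≤ pointStab ⊤ u := by
    refine sup_le (fun a ha => ⟨trivial, hA a ha⟩) ?_
    rw [Subgroup.zpowers_le]
    exact ⟨trivial, hs⟩
  exact fun x hx => (this hx).2

theorem exists_reflectionGroup_of_hasAxis {G : Subgroup O3} [Finite G] {u : E3} (hu : ‖u‖ = 1)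
    (hG : HasAxis G u) :
    ∃ G' : Subgroup O3, G ≤ G' ∧ Finite G' ∧ IsReflectionGroup G' ∧ G.relIndex G' ≤ 4 ∧
      (¬ IsRotoreflectionGroup G u → G.relIndex G' ≤ 2) := by
  have hu0 := ne_zero_of_norm_eq_one hu
  set σ := planeReflection u with hσ
  have hσr : IsPlaneReflection σ := .planeReflection hu0
  have hσu : σ u = -u := planeReflection_apply_self u
  have hσG : σ * σ ∈ G := by rw [hσr.mul_self]; exact G.one_mem
  have hσn : ∀ g ∈ G, σ * g * σ⁻¹ ∈ G := fun g hg => by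
    rwa [planeReflection_conj hu (hG g hg)]
  set G₁ := G ⊔ Subgroup.zpowers σ
  have hfin₁ : Finite G₁ := Subgroup.finite_sup_zpowers_of_sq_mem hσG hσn
  have hi₁ : G.relIndex G₁ ≤ 2 := Subgroup.relIndex_sup_zpowers_le_two hσG hσn
  have hσ₁ : σ ∈ G₁ := (le_sup_right : _ ≤ G₁) (Subgroup.mem_zpowers σ)
  have hax₁ : HasAxis G₁ u := by
    intro x hx
    rcases (Subgroup.mem_sup_zpowers_iff_of_sq_mem hσG hσn).1 hx with h | h
    · exact hG x h
    · have h1 : x u = σ ((σ * x) u) := by rw [← O3.mul_apply, planeReflection_mul_cancel]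
      rw [h1]
      rcases hG _ h with h | h <;> rw [h]
      · exact Or.inr hσu
      · left; rw [map_neg, hσu, neg_neg]
  -- With `σ` adjoined, any element reversing `u` can be corrected to one fixing it, so `A` and `σ`
  -- generate `G₁`. It remains to see whether `A` contains a reflection or needs `s`.
  set A := pointStab G₁ u
  have hA₁ : A ≤ G₁ := pointStab_le _ _
  have hAu : ∀ a ∈ A, a u = u := fun a ha => ha.2
  have hmemA : ∀ x ∈ G₁, x ∈ A ∨ σ * x ∈ A := by
    intro x hx
    rcases hax₁ x hx with h | h
    · exact Or.inl ⟨hx, h⟩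
    · exact Or.inr ⟨G₁.mul_mem hσ₁ hx, by rw [O3.mul_apply, h, map_neg, hσu, neg_neg]⟩
  have hG₁A : G₁ = A ⊔ Subgroup.zpowers σ := by
    have h1 : A ≤ A ⊔ Subgroup.zpowers σ := le_sup_left
    have h2 : σ ∈ A ⊔ Subgroup.zpowers σ :=
      (le_sup_right : _ ≤ A ⊔ Subgroup.zpowers σ) (Subgroup.mem_zpowers σ)
    apply le_antisymm
    · intro x hx
      rcases hmemA x hx with h | h
      · exact h1 h
      · exact (Subgroup.mul_mem_cancel_left _ h2).1 (h1 h)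
    · exact sup_le hA₁ (by rwa [Subgroup.zpowers_le])
  by_cases hrefl : ∃ a ∈ A, detO a = -1
  · obtain ⟨a, ha, had⟩ := hrefl
    refine ⟨G₁, le_sup_left, hfin₁, ?_, by omega, fun _ => hi₁⟩
    rw [hG₁A]
    exact (isReflectionGroup_of_fixed hu0 hAu ha had).sup_zpowers hσr
  push Not at hrefl
  have hArot : ∀ a ∈ A, detO a = 1 := fun a ha =>
    (detO_eq_one_or_neg_one a).resolve_right (hrefl a ha)
  obtain ⟨s, hs, hsu, -⟩ := exists_isPlaneReflection_fixing u u
  have hmem_s : ∀ B : Subgroup O3, s ∈ B ⊔ Subgroup.zpowers s := fun B =>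
    (le_sup_right : _ ≤ B ⊔ Subgroup.zpowers s) (Subgroup.mem_zpowers s)
  by_cases hGA : ∀ g ∈ G, g u = u
  · have hss : s * s ∈ G := by rw [hs.mul_self]; exact G.one_mem
    have hsn : ∀ g ∈ G, s * g * s⁻¹ ∈ G := fun g hg => by
      rw [hs.conj_eq_inv hu0 hsu (hArot g ⟨(le_sup_left : G ≤ G₁) hg, hGA g hg⟩) (hGA g hg)]
      exact G.inv_mem hg
    have hi := Subgroup.relIndex_sup_zpowers_le_two hss hsn
    exact ⟨_, le_sup_left, Subgroup.finite_sup_zpowers_of_sq_mem hss hsn,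
      isReflectionGroup_of_fixed hu0 (mem_of_mem_pointStab_sup hGA hsu) (hmem_s G) hs.detO_eq,
      by omega, fun _ => hi⟩
  push Not at hGA
  obtain ⟨g₀, hg₀, hg₀u⟩ := hGA
  have hss : s * s ∈ G₁ := by rw [hs.mul_self]; exact G₁.one_mem
  have hsA : ∀ a ∈ A, s * a * s⁻¹ = a⁻¹ := fun a ha =>
    hs.conj_eq_inv hu0 hsu (hArot a ha) (hAu a ha)
  have hsn : ∀ g ∈ G₁, s * g * s⁻¹ ∈ G₁ := by
    intro g hg
    rcases hmemA g hg with h | h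
    · rw [hsA g h]
      exact G₁.inv_mem hg
    · have h1 : s * g * s⁻¹ = σ * (σ * g)⁻¹ := by
        have hc : s * σ = σ * s := planeReflection_comm hu (Or.inl hsu)
        rw [← hsA _ h]
        calc s * g * s⁻¹ = s * (σ * (σ * g)) * s⁻¹ := by rw [planeReflection_mul_cancel]
          _ = s * σ * (σ * g) * s⁻¹ := by simp only [mul_assoc]
          _ = σ * (s * (σ * g) * s⁻¹) := by rw [hc]; simp only [mul_assoc]
      rw [h1]
      exact G₁.mul_mem hσ₁ (G₁.inv_mem (hA₁ h))
  have hi₂ := Subgroup.relIndex_sup_zpowers_le_two hss hsn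
  have hrefl₂ : IsReflectionGroup (G₁ ⊔ Subgroup.zpowers s) := by
    rw [hG₁A, sup_right_comm]
    exact (isReflectionGroup_of_fixed hu0 (mem_of_mem_pointStab_sup hAu hsu) (hmem_s A)
      hs.detO_eq).sup_zpowers hσr
  have hi : G.relIndex (G₁ ⊔ Subgroup.zpowers s) =
      G.relIndex G₁ * G₁.relIndex (G₁ ⊔ Subgroup.zpowers s) :=
    (Subgroup.relIndex_mul_relIndex _ _ _ le_sup_left le_sup_left).symm
  refine ⟨G₁ ⊔ Subgroup.zpowers s, le_sup_left.trans le_sup_left,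
    Subgroup.finite_sup_zpowers_of_sq_mem hss hsn, hrefl₂, ?_, ?_⟩
  · rw [hi]
    exact Nat.mul_le_mul hi₁ hi₂
  · intro hnot
    -- Since `A` has no improper element, all other conditions for a rotoreflection group hold: an
    -- element `g` reversing `u` satisfies `detO (σ * g) = 1`. Only `σ ∈ G` can fail them, and then
    -- `G₁ = G`.
    have hσmem : σ ∈ G := by
      by_contra hσ'
      refine hnot ⟨hu, hG, fun g hg hgu => hArot g ⟨(le_sup_left : G ≤ G₁) hg, hgu⟩, ?_,
        ⟨g₀, hg₀, (hG g₀ hg₀).resolve_left hg₀u⟩, hσ'⟩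
      intro g hg hgu
      have h1 : detO (σ * g) = 1 := hArot _ ⟨G₁.mul_mem hσ₁ ((le_sup_left : G ≤ G₁) hg), by
        rw [O3.mul_apply, hgu, map_neg, hσu, neg_neg]⟩
      rw [map_mul, hσr.detO_eq] at h1
      linarith
    have h1 : G.relIndex G₁ = 1 := by
      have : G₁ = G := by
        rw [sup_eq_left, Subgroup.zpowers_le]; exact hσmem
      rw [this, Subgroup.relIndex_self]
    rw [hi, h1, one_mul]
    exact hi₂

/-! ### The quotient of the sphere by a rotoreflection group -/

/-- The entries of the matrix `x xᵀ` separate antipodal pairs continuously. -/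
instance : T2Space RP2 := by
  let f : S2 → Fin 3 → Fin 3 → ℝ := fun x i j => (x : E3) i * (x : E3) j
  have hf : Continuous f := by fun_prop
  have hlift : ∀ x y : S2, antipodalSetoid x y → f x = f y := by
    rintro x y (h | h) <;> funext i j
    · simp [f, h]
    · simp [f, h]
  refine T2Space.of_injective_continuous (f := Quotient.lift f hlift) ?_ (hf.quotient_lift hlift)
  intro p q
  induction p using Quotient.inductionOn with | _ x
  induction q using Quotient.inductionOn with | _ y
  intro h
  have hxy : ∀ i j, (x : E3) i * (x : E3) j = (y : E3) i * (y : E3) j :=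
    fun i j => congrFun (congrFun h i) j
  have hx : ‖(x : E3)‖ = 1 := mem_sphere_zero_iff_norm.1 x.2
  have hy : ‖(y : E3)‖ = 1 := mem_sphere_zero_iff_norm.1 y.2
  have hy2 : (y : E3) 0 ^ 2 + (y : E3) 1 ^ 2 + (y : E3) 2 ^ 2 = 1 := by
    have := EuclideanSpace.real_norm_sq_eq (y : E3)
    rw [hy, Fin.sum_univ_three] at this
    linarith
  refine Quotient.sound (?_ : (y : E3) = x ∨ (y : E3) = -x)
  refine eq_or_eq_neg_of_eq_smul hx hy
    -- The scalar is the inner product: applying `x xᵀ = y yᵀ` to the unit vector `y` gives `⟨x, y⟩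
    -- x = y`.
    (c := (x : E3) 0 * (y : E3) 0 + (x : E3) 1 * (y : E3) 1 + (x : E3) 2 * (y : E3) 2) ?_
  ext j
  rw [PiLp.smul_apply, smul_eq_mul]
  linear_combination -(y : E3) 0 * hxy 0 j - (y : E3) 1 * hxy 1 j - (y : E3) 2 * hxy 2 j -
    (y : E3) j * hy2

/-! ### Complex coordinates around an axis. -/

/-- The complex coordinate in the plane spanned by the first two vectors of a basis. -/
noncomputable def axisCoord (b : OrthonormalBasis (Fin 3) ℝ E3) (x : E3) : ℂ :=
  ⟨inner ℝ (b 0) x, inner ℝ (b 1) x⟩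

theorem norm_axisCoord (b : OrthonormalBasis (Fin 3) ℝ E3) (x : E3) :
    ‖axisCoord b x‖ ^ 2 + inner ℝ (b 2) x ^ 2 = ‖x‖ ^ 2 := by
  have h := b.sum_sq_norm_inner_right x
  rw [Fin.sum_univ_three] at h
  simp only [Real.norm_eq_abs, sq_abs] at h
  rw [Complex.sq_norm, Complex.normSq_apply, ← h, axisCoord]
  ring

theorem eq_of_axisCoord_eq (b : OrthonormalBasis (Fin 3) ℝ E3) {x y : E3}
    (h : axisCoord b x = axisCoord b y) (h2 : inner ℝ (b 2) x = inner ℝ (b 2) y) : x = y := by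
  apply b.repr.injective
  ext i
  rw [b.repr_apply_apply, b.repr_apply_apply]
  fin_cases i
  · exact congrArg Complex.re h
  · exact congrArg Complex.im h
  · exact h2

theorem exists_orthonormalBasis_axis {u : E3} (hu : ‖u‖ = 1) :
    ∃ b : OrthonormalBasis (Fin 3) ℝ E3, b 2 = u := by
  have hv : Orthonormal ℝ (({2} : Set (Fin 3)).domRestrict fun _ => u) :=
    ⟨fun _ => hu, fun i j h => absurd (Subsingleton.elim i j) h⟩
  obtain ⟨b, hb⟩ := hv.exists_orthonormalBasis_extension_of_card_eq (by simp)
  exact ⟨b, hb 2 rfl⟩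

/-- A rotation about the third basis vector acts on the complex coordinate by multiplication. -/
theorem axisCoord_rotation {b : OrthonormalBasis (Fin 3) ℝ E3} {g : O3} (hg : detO g = 1)
    (hgu : g (b 2) = b 2) (x : E3) : axisCoord b (g x) = axisCoord b (g (b 0)) * axisCoord b x := by
  have hM : ∀ i j, LinearMap.toMatrix b.toBasis b.toBasis (g.toLinearEquiv : E3 →ₗ[ℝ] E3) i j =
      inner ℝ (b i) (g (b j)) := by
    intro i j
    rw [LinearMap.toMatrix_apply, b.coe_toBasis_repr_apply, b.repr_apply_apply, b.coe_toBasis]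
    rfl
  have hdet := LinearMap.det_toMatrix b.toBasis (g.toLinearEquiv : E3 →ₗ[ℝ] E3)
  have hrow : ∀ j, inner ℝ (b 2) (g (b j)) = inner ℝ (b 2) (b j) := fun j => by
    conv_lhs => rw [← hgu]
    exact g.inner_map_map _ _
  have hb : ∀ i j, inner ℝ (b i) (b j) = if i = j then (1 : ℝ) else 0 :=
    fun i j => orthonormal_iff_ite.1 b.orthonormal i j
  rw [Matrix.det_fin_three, (show LinearMap.det _ = (1 : ℝ) from hg)] at hdet
  simp only [hM, hgu, hrow, hb] at hdet
  have hcol : ∀ j k, inner ℝ (b 0) (g (b j)) * inner ℝ (b 0) (g (b k)) +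
      inner ℝ (b 1) (g (b j)) * inner ℝ (b 1) (g (b k)) +
      inner ℝ (b 2) (b j) * inner ℝ (b 2) (b k) = if j = k then (1 : ℝ) else 0 := by
    intro j k
    have h := b.sum_inner_mul_inner (g (b j)) (g (b k))
    rw [Fin.sum_univ_three, real_inner_comm (b 0), real_inner_comm (b 1), real_inner_comm (b 2),
      hrow, hrow, g.inner_map_map, hb j k] at h
    exact h
  have h00 := hcol 0 0
  have h01 := hcol 0 1
  have h11 := hcol 1 1
  simp only [hb] at h00 h01 h11
  have hx : g x = inner ℝ (b 0) x • g (b 0) + inner ℝ (b 1) x • g (b 1) + inner ℝ (b 2) x • b 2 := by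
    conv_lhs => rw [← b.sum_repr' x, Fin.sum_univ_three]
    rw [map_add, map_add, map_smul, map_smul, map_smul, hgu]
  have hx0 : inner ℝ (b 0) (g x) = inner ℝ (b 0) x * inner ℝ (b 0) (g (b 0)) +
      inner ℝ (b 1) x * inner ℝ (b 0) (g (b 1)) := by
    rw [hx]
    simp [inner_add_right, inner_smul_right, hb]
  have hx1 : inner ℝ (b 1) (g x) = inner ℝ (b 0) x * inner ℝ (b 1) (g (b 0)) +
      inner ℝ (b 1) x * inner ℝ (b 1) (g (b 1)) := by
    rw [hx]
    simp [inner_add_right, inner_smul_right, hb]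
  simp at hdet h00 h01 h11
  unfold axisCoord
  rw [hx0, hx1]
  generalize inner ℝ (b 0) (g (b 0)) = α at *
  generalize inner ℝ (b 1) (g (b 0)) = β at *
  generalize inner ℝ (b 0) (g (b 1)) = γ at *
  generalize inner ℝ (b 1) (g (b 1)) = δ at *
  -- The two unit columns contribute 2 and the determinant term subtracts 2, leaving the
  -- Cauchy–Riemann form of the planar block.
  have hs : (α - δ) ^ 2 + (β + γ) ^ 2 = 0 := by linear_combination h00 + h11 - 2 * hdet
  have h1 : α = δ := by nlinarith [sq_nonneg (α - δ), sq_nonneg (β + γ)]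
  have h2 : γ = -β := by nlinarith [sq_nonneg (α - δ), sq_nonneg (β + γ)]
  apply Complex.ext
  · simp only [Complex.mul_re, h2]
    ring
  · simp only [Complex.mul_im, ← h1]
    ring

/-! ### Norm-preserving power maps of the plane and of space. -/

/-- The map `z ↦ z ^ (m + 1) / ‖z‖ ^ m`, which preserves absolute values. -/
noncomputable def normalizedPow (m : ℕ) (z : ℂ) : ℂ := z * (z / ‖z‖) ^ m

theorem norm_normalizedPow (m : ℕ) (z : ℂ) : ‖normalizedPow m z‖ = ‖z‖ := by
  rcases eq_or_ne z 0 with rfl | hz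
  · simp [normalizedPow]
  · rw [normalizedPow, norm_mul, norm_pow, norm_div, Complex.norm_real, norm_norm,
      div_self (norm_ne_zero_iff.2 hz), one_pow, mul_one]

/-- At the origin, where the quotient formula says nothing, continuity comes from preservation of
the norm. -/
theorem continuous_normalizedPow (m : ℕ) : Continuous (normalizedPow m) := by
  rw [continuous_iff_continuousAt]
  intro z
  rcases eq_or_ne z 0 with rfl | hz
  · have h0 : normalizedPow m 0 = 0 := by simp [normalizedPow]
    rw [ContinuousAt, h0, tendsto_zero_iff_norm_tendsto_zero]
    simp only [norm_normalizedPow]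
    exact tendsto_norm_zero
  · have : ((‖z‖ : ℝ) : ℂ) ≠ 0 := by simpa using hz
    unfold normalizedPow
    fun_prop (disch := assumption)

theorem normalizedPow_mul (m : ℕ) {ζ : ℂ} (hζ : ‖ζ‖ = 1) (z : ℂ) :
    normalizedPow m (ζ * z) = ζ ^ (m + 1) * normalizedPow m z := by
  rw [normalizedPow, normalizedPow, norm_mul, hζ, one_mul, mul_div_assoc, mul_pow]
  ring

theorem normalizedPow_surjective (m : ℕ) : Function.Surjective (normalizedPow m) := by
  intro y
  rcases eq_or_ne y 0 with rfl | hy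
  · exact ⟨0, by simp [normalizedPow]⟩
  have hn : ((‖y‖ : ℝ) : ℂ) ≠ 0 := by simpa using hy
  obtain ⟨ζ, hζ⟩ := IsAlgClosed.exists_pow_nat_eq (y / ‖y‖) (Nat.succ_pos m)
  have h1 : ‖ζ‖ = 1 := by
    have h : ‖ζ‖ ^ (m + 1) = 1 := by
      rw [← norm_pow, hζ, norm_div, Complex.norm_real, norm_norm, div_self (norm_ne_zero_iff.2 hy)]
    exact (pow_eq_one_iff_of_nonneg (norm_nonneg _) (Nat.succ_ne_zero m)).1 h
  refine ⟨ζ * ‖y‖, ?_⟩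
  have h2 : normalizedPow m (‖y‖ : ℂ) = ‖y‖ := by
    rw [normalizedPow, Complex.norm_real, norm_norm, div_self hn, one_pow, mul_one]
  rw [normalizedPow_mul m h1, hζ, h2, div_mul_cancel₀ _ hn]

theorem exists_root_of_normalizedPow_eq {m : ℕ} {z z' : ℂ}
    (h : normalizedPow m z = normalizedPow m z') : ∃ ζ : ℂ, ζ ^ (m + 1) = 1 ∧ z' = ζ * z := by
  have hn : ‖z‖ = ‖z'‖ := by rw [← norm_normalizedPow m z, h, norm_normalizedPow]
  rcases eq_or_ne z 0 with rfl | hz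
  · refine ⟨1, one_pow _, ?_⟩
    rw [norm_zero] at hn
    rw [mul_zero, norm_eq_zero.1 hn.symm]
  have h1 : ‖z' / z‖ = 1 := by rw [norm_div, ← hn, div_self (norm_ne_zero_iff.2 hz)]
  have h2 : z' = z' / z * z := (div_mul_cancel₀ _ hz).symm
  refine ⟨z' / z, ?_, h2⟩
  rw [h2, normalizedPow_mul m h1] at h
  have h3 : normalizedPow m z ≠ 0 := by
    rw [← norm_ne_zero_iff, norm_normalizedPow]
    exact norm_ne_zero_iff.2 hz
  exact mul_right_cancel₀ h3 (by rw [one_mul]; exact h.symm)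

theorem continuous_axisCoord (b : OrthonormalBasis (Fin 3) ℝ E3) : Continuous (axisCoord b) := by
  have h : axisCoord b = fun x => Complex.equivRealProdCLM.symm (inner ℝ (b 0) x, inner ℝ (b 1) x) := by
    funext x
    rfl
  rw [h]
  fun_prop

/-- The map of Euclidean space given by `normalizedPow` in the plane orthogonal to an axis. -/
noncomputable def axisPow (b : OrthonormalBasis (Fin 3) ℝ E3) (m : ℕ) (x : E3) : E3 :=
  !₂[(normalizedPow m (axisCoord b x)).re, (normalizedPow m (axisCoord b x)).im, inner ℝ (b 2) x]

theorem norm_axisPow (b : OrthonormalBasis (Fin 3) ℝ E3) (m : ℕ) (x : E3) :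
    ‖axisPow b m x‖ = ‖x‖ := by
  rw [← sq_eq_sq₀ (norm_nonneg _) (norm_nonneg _), ← norm_axisCoord b x,
    ← norm_normalizedPow m, EuclideanSpace.real_norm_sq_eq, Fin.sum_univ_three, Complex.sq_norm,
    Complex.normSq_apply]
  simp [axisPow, sq]

theorem continuous_axisPow (b : OrthonormalBasis (Fin 3) ℝ E3) (m : ℕ) :
    Continuous (axisPow b m) := by
  have h := (continuous_normalizedPow m).comp (continuous_axisCoord b)
  have h1 : Continuous fun x => (normalizedPow m (axisCoord b x)).re := Complex.continuous_re.comp h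
  have h2 : Continuous fun x => (normalizedPow m (axisCoord b x)).im := Complex.continuous_im.comp h
  unfold axisPow
  refine (PiLp.continuous_toLp 2 _).comp (continuous_pi fun i => ?_)
  fin_cases i
  · exact h1
  · exact h2
  · exact continuous_const.inner continuous_id

theorem axisPow_eq_iff {b : OrthonormalBasis (Fin 3) ℝ E3} {m : ℕ} {x y : E3} :
    axisPow b m x = axisPow b m y ↔
      normalizedPow m (axisCoord b x) = normalizedPow m (axisCoord b y) ∧
        inner ℝ (b 2) x = inner ℝ (b 2) y := by
  constructor
  · intro h
    refine ⟨Complex.ext ?_ ?_, ?_⟩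
    · exact congrArg (fun v : E3 => v 0) h
    · exact congrArg (fun v : E3 => v 1) h
    · exact congrArg (fun v : E3 => v 2) h
  · rintro ⟨h, h'⟩
    rw [axisPow, axisPow, h, h']

theorem axisPow_surjective (b : OrthonormalBasis (Fin 3) ℝ E3) (m : ℕ) :
    Function.Surjective (axisPow b m) := by
  intro y
  obtain ⟨z, hz⟩ := normalizedPow_surjective m ⟨y 0, y 1⟩
  set x := b.repr.symm !₂[z.re, z.im, y 2]
  have hx : ∀ i, inner ℝ (b i) x = !₂[z.re, z.im, y 2] i := by
    intro i
    rw [← b.repr_apply_apply, LinearIsometryEquiv.apply_symm_apply]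
  have h1 : axisCoord b x = z := Complex.ext (hx 0) (hx 1)
  refine ⟨x, ?_⟩
  ext i
  fin_cases i
  · simp [axisPow, h1, hz]
  · simp [axisPow, h1, hz]
  · exact hx 2

/-! ### Rotoreflection groups and the projective plane. -/

namespace IsRotoreflectionGroup

variable {G : Subgroup O3} {b : OrthonormalBasis (Fin 3) ℝ E3}

theorem axisCoord_planeReflection (b : OrthonormalBasis (Fin 3) ℝ E3) (x : E3) :
    axisCoord b (planeReflection (b 2) x) = axisCoord b x := by
  have h0 : inner ℝ (b 0) (b 2) = (0 : ℝ) := b.orthonormal.2 (by decide)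
  have h1 : inner ℝ (b 1) (b 2) = (0 : ℝ) := b.orthonormal.2 (by decide)
  rw [planeReflection_apply (b.orthonormal.1 2)]
  simp [axisCoord, inner_sub_right, inner_smul_right, h0, h1]

theorem inner_planeReflection (b : OrthonormalBasis (Fin 3) ℝ E3) (x : E3) :
    inner ℝ (b 2) (planeReflection (b 2) x) = -inner ℝ (b 2) x := by
  have h : inner ℝ (b 2) (b 2) = (1 : ℝ) := by
    rw [real_inner_self_eq_norm_sq, b.orthonormal.1 2, one_pow]
  rw [planeReflection_apply (b.orthonormal.1 2), inner_sub_right, inner_smul_right, h]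
  ring

theorem inner_of_fixed {g : O3} (hg : g (b 2) = b 2) (x : E3) :
    inner ℝ (b 2) (g x) = inner ℝ (b 2) x := by
  conv_lhs => rw [← hg]
  exact g.inner_map_map _ _

theorem inner_of_reversed {g : O3} (hg : g (b 2) = -b 2) (x : E3) :
    inner ℝ (b 2) (g x) = -inner ℝ (b 2) x := by
  rw [← g.inner_map_map (b 2) x, hg, inner_neg_left, neg_neg]

/-- Composing a reversing element with the reflection in the plane orthogonal to the axis makes it a
rotation about the axis without changing planar coordinates. -/
theorem axisCoord_apply (hG : IsRotoreflectionGroup G (b 2)) {g : O3} (hg : g ∈ G) (x : E3) :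
    axisCoord b (g x) = axisCoord b (g (b 0)) * axisCoord b x := by
  rcases hG.hasAxis g hg with h | h
  · exact axisCoord_rotation (hG.detO_of_fixed g hg h) h x
  · have h1 : detO (planeReflection (b 2) * g) = 1 := by
      rw [map_mul, detO_planeReflection (ne_zero_of_norm_eq_one hG.norm_eq),
        hG.detO_of_reversed g hg h]
      norm_num
    have h2 : (planeReflection (b 2) * g) (b 2) = b 2 := by
      rw [O3.mul_apply, h, map_neg, planeReflection_apply_self, neg_neg]
    have h3 := axisCoord_rotation h1 h2 x
    rwa [O3.mul_apply, O3.mul_apply, axisCoord_planeReflection, axisCoord_planeReflection] at h3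

theorem axisCoord_basis_zero (b : OrthonormalBasis (Fin 3) ℝ E3) : axisCoord b (b 0) = 1 := by
  have h0 : inner ℝ (b 0) (b 0) = (1 : ℝ) := by
    rw [real_inner_self_eq_norm_sq, b.orthonormal.1 0, one_pow]
  have h1 : inner ℝ (b 1) (b 0) = (0 : ℝ) := b.orthonormal.2 (by decide)
  apply Complex.ext
  · exact h0
  · exact h1

/-- The angle of rotation of the elements of a rotoreflection group, as a complex number. -/
noncomputable def angleHom (hG : IsRotoreflectionGroup G (b 2)) : G →* ℂ where
  toFun g := axisCoord b ((g : O3) (b 0))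
  map_one' := axisCoord_basis_zero b
  map_mul' g h := hG.axisCoord_apply g.2 ((h : O3) (b 0))

theorem axisCoord_eq (hG : IsRotoreflectionGroup G (b 2)) (g : G) (x : E3) :
    axisCoord b ((g : O3) x) = hG.angleHom g * axisCoord b x :=
  hG.axisCoord_apply g.2 x

theorem eq_of_angleHom_eq (hG : IsRotoreflectionGroup G (b 2)) {g h : G}
    (h1 : hG.angleHom g = hG.angleHom h) (h2 : (g : O3) (b 2) = (h : O3) (b 2)) : g = h := by
  apply Subtype.ext
  ext1 x
  refine eq_of_axisCoord_eq b ?_ ?_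
  · rw [hG.axisCoord_eq, hG.axisCoord_eq, h1]
  · rcases hG.hasAxis h h.2 with h3 | h3
    · rw [inner_of_fixed (h2.trans h3), inner_of_fixed h3]
    · rw [inner_of_reversed (h2.trans h3), inner_of_reversed h3]

theorem angleHom_pow_of_fixed (hG : IsRotoreflectionGroup G (b 2)) {g : G}
    (hg : (g : O3) (b 2) = b 2) : hG.angleHom g ^ Nat.card (pointStab G (b 2)) = 1 := by
  have h : (⟨g, g.2, hg⟩ : pointStab G (b 2)) ^ Nat.card (pointStab G (b 2)) = 1 :=
    pow_card_eq_one'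
  have h' : g ^ Nat.card (pointStab G (b 2)) = 1 := 
    Subtype.ext (congrArg (fun c : pointStab G (b 2) => (c : O3)) h)
  rw [← map_pow, h', map_one]

/-- Angles embed the axis stabilizer, of order `n`, into the `n`-th roots of unity; as there are at
most `n` of these, all occur. -/
theorem exists_angleHom_eq [Finite G] (hG : IsRotoreflectionGroup G (b 2)) {ζ : ℂ}
    (hζ : ζ ^ Nat.card (pointStab G (b 2)) = 1) :
    ∃ g : G, (g : O3) (b 2) = b 2 ∧ hG.angleHom g = ζ := by
  classical
  have hfin : Finite (pointStab G (b 2)) := Subgroup.finite_of_le (pointStab_le _ _)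
  have := Fintype.ofFinite (pointStab G (b 2))
  have hpos : 0 < Nat.card (pointStab G (b 2)) := Nat.card_pos
  let f : pointStab G (b 2) → ℂ := fun c => hG.angleHom ⟨c, c.2.1⟩
  have hf : Function.Injective f := by
    intro c d h
    have := hG.eq_of_angleHom_eq h (c.2.2.trans d.2.2.symm)
    exact Subtype.ext (congrArg (fun c : G => (c : O3)) this)
  have hsub : Finset.univ.image f ⊆ Polynomial.nthRootsFinset (Nat.card (pointStab G (b 2))) 1 := by
    intro z hz
    obtain ⟨c, -, rfl⟩ := Finset.mem_image.1 hz
    rw [Polynomial.mem_nthRootsFinset hpos]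
    exact hG.angleHom_pow_of_fixed c.2.2
  have hcard : (Polynomial.nthRootsFinset (Nat.card (pointStab G (b 2))) (1 : ℂ)).card ≤
      (Finset.univ.image f).card := by
    rw [Finset.card_image_of_injective _ hf, Finset.card_univ, ← Nat.card_eq_fintype_card,
      Polynomial.nthRootsFinset_def]
    exact (Multiset.toFinset_card_le _).trans (Polynomial.card_nthRoots _ _)
  have hmem := (Polynomial.mem_nthRootsFinset hpos (1 : ℂ)).2 hζ
  rw [← Finset.eq_of_subset_of_card_le hsub hcard] at hmem
  obtain ⟨c, -, hc⟩ := Finset.mem_image.1 hmem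
  exact ⟨⟨c, c.2.1⟩, c.2.2, hc⟩

/-- As `g * g` fixes the axis, the power is `1` or `-1`. The value `1` would yield a rotation `c ∈
G` with the same angle, and `c⁻¹ * g` would be the excluded reflection. -/
theorem angleHom_pow_of_reversed [Finite G] (hG : IsRotoreflectionGroup G (b 2)) {g : G}
    (hg : (g : O3) (b 2) = -b 2) : hG.angleHom g ^ Nat.card (pointStab G (b 2)) = -1 := by
  have h1 : ((g * g : G) : O3) (b 2) = b 2 := by
    rw [Subgroup.coe_mul, O3.mul_apply, hg, map_neg, hg, neg_neg]
  have h2 := hG.angleHom_pow_of_fixed h1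
  rw [map_mul, mul_pow] at h2
  refine (mul_self_eq_one_iff.1 h2).resolve_left fun h3 => hG.reflection_not_mem ?_
  obtain ⟨c, hc, hcg⟩ := hG.exists_angleHom_eq h3
  have h4 : (c : O3) * planeReflection (b 2) = g := by
    ext1 x
    refine eq_of_axisCoord_eq b ?_ ?_
    · rw [O3.mul_apply, hG.axisCoord_eq, hcg, hG.axisCoord_eq, axisCoord_planeReflection]
    · rw [O3.mul_apply, inner_of_fixed hc, inner_planeReflection, inner_of_reversed hg]
  have h5 := g.2
  rw [← h4] at h5
  exact (Subgroup.mul_mem_cancel_left _ c.2).1 h5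

theorem norm_angleHom (hG : IsRotoreflectionGroup G (b 2)) (g : G) : ‖hG.angleHom g‖ = 1 := by
  have h := norm_axisCoord b ((g : O3) (b 0))
  have h0 : inner ℝ (b 2) (b 0) = (0 : ℝ) := b.orthonormal.2 (by decide)
  have h1 : inner ℝ (b 2) ((g : O3) (b 0)) = 0 := by
    rcases hG.hasAxis g g.2 with h3 | h3
    · rw [inner_of_fixed h3, h0]
    · rw [inner_of_reversed h3, h0, neg_zero]
  rw [h1, LinearIsometryEquiv.norm_map, b.orthonormal.1 0, one_pow] at h
  have h2 : ‖hG.angleHom g‖ ^ 2 = 1 := by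
    rw [zero_pow two_ne_zero, add_zero] at h
    exact h
  exact (pow_eq_one_iff_of_nonneg (norm_nonneg _) two_ne_zero).1 h2

theorem axisPow_of_fixed [Finite G] (hG : IsRotoreflectionGroup G (b 2)) {m : ℕ}
    (hm : Nat.card (pointStab G (b 2)) = m + 1) {g : G} (hg : (g : O3) (b 2) = b 2) (x : E3) :
    axisPow b m ((g : O3) x) = axisPow b m x := by
  rw [axisPow_eq_iff, hG.axisCoord_eq, normalizedPow_mul m (hG.norm_angleHom g), ← hm,
    hG.angleHom_pow_of_fixed hg, one_mul]
  exact ⟨rfl, inner_of_fixed hg x⟩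

theorem axisPow_of_reversed [Finite G] (hG : IsRotoreflectionGroup G (b 2)) {m : ℕ}
    (hm : Nat.card (pointStab G (b 2)) = m + 1) {g : G} (hg : (g : O3) (b 2) = -b 2) (x : E3) :
    axisPow b m ((g : O3) x) = -axisPow b m x := by
  rw [axisPow, axisPow, hG.axisCoord_eq, normalizedPow_mul m (hG.norm_angleHom g), ← hm,
    hG.angleHom_pow_of_reversed hg, inner_of_reversed hg]
  ext i
  fin_cases i <;> simp

theorem exists_of_axisPow_eq [Finite G] (hG : IsRotoreflectionGroup G (b 2)) {m : ℕ}
    (hm : Nat.card (pointStab G (b 2)) = m + 1) {x y : E3} (h : axisPow b m x = axisPow b m y) :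
    ∃ g ∈ G, g x = y := by
  obtain ⟨h1, h2⟩ := axisPow_eq_iff.1 h
  obtain ⟨ζ, hζ, hz⟩ := exists_root_of_normalizedPow_eq h1
  obtain ⟨g, hg, hgζ⟩ := hG.exists_angleHom_eq (by rw [hm]; exact hζ)
  refine ⟨g, g.2, eq_of_axisCoord_eq b ?_ ?_⟩
  · rw [hG.axisCoord_eq, hgζ, hz]
  · rw [inner_of_fixed hg, h2]

/-- Elements fixing the axis leave `axisPow` unchanged and reversing ones negate it, so the orbits
are exactly the preimages of antipodal pairs. The induced continuous bijection goes from a compact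
to a Hausdorff space. The stabilizer order is `m + 1`, matching the exponent in `normalizedPow m`.
-/
theorem nonempty_homeomorph [Finite G] (hG : IsRotoreflectionGroup G (b 2)) :
    Nonempty (SphericalQuotient G ≃ₜ RP2) := by
  have hfin : Finite (pointStab G (b 2)) := Subgroup.finite_of_le (pointStab_le _ _)
  obtain ⟨m, hm⟩ := Nat.exists_eq_succ_of_ne_zero
    (Nat.card_pos : 0 < Nat.card (pointStab G (b 2))).ne'
  let F : S2 → S2 := fun x => ⟨axisPow b m x, by
    rw [mem_sphere_zero_iff_norm, norm_axisPow, mem_sphere_zero_iff_norm.1 x.2]⟩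
  have hF : Continuous F := ((continuous_axisPow b m).comp continuous_subtype_val).subtype_mk _
  let f : S2 → RP2 := fun x => Quotient.mk _ (F x)
  have hf : Continuous f := continuous_quotient_mk'.comp hF
  have hfwd : ∀ x y : S2, orbitSetoid G x y → f x = f y := by
    rintro x y ⟨g, hg, hxy⟩
    refine Quotient.sound (?_ : axisPow b m y = axisPow b m x ∨ axisPow b m y = -axisPow b m x)
    rw [← hxy]
    rcases hG.hasAxis g hg with h | h
    · exact Or.inl (hG.axisPow_of_fixed hm (g := ⟨g, hg⟩) h x)
    · exact Or.inr (hG.axisPow_of_reversed hm (g := ⟨g, hg⟩) h x)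
  have hbwd : ∀ x y : S2, f x = f y → orbitSetoid G x y := by
    intro x y h
    have h1 : axisPow b m y = axisPow b m x ∨ axisPow b m y = -axisPow b m x := Quotient.exact h
    rcases h1 with h1 | h1
    · exact hG.exists_of_axisPow_eq hm h1.symm
    · obtain ⟨g, hg, hgu⟩ := hG.exists_reversing
      rw [← hG.axisPow_of_reversed hm (g := ⟨g, hg⟩) hgu] at h1
      obtain ⟨c, hc, hcx⟩ := hG.exists_of_axisPow_eq hm h1.symm
      exact ⟨c * g, G.mul_mem hc hg, hcx⟩
  have hbij : Function.Bijective (Quotient.lift f hfwd : SphericalQuotient G → RP2) := by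
    constructor
    · intro p q
      induction p using Quotient.inductionOn with | _ x
      induction q using Quotient.inductionOn with | _ y
      exact fun h => Quotient.sound (hbwd x y h)
    · intro p
      induction p using Quotient.inductionOn with | _ y
      obtain ⟨x, hx⟩ := axisPow_surjective b m (y : E3)
      have hx1 : ‖x‖ = 1 := by
        rw [← norm_axisPow b m x, hx, mem_sphere_zero_iff_norm.1 y.2]
      refine ⟨Quotient.mk _ ⟨x, mem_sphere_zero_iff_norm.2 hx1⟩, ?_⟩
      exact congrArg (Quotient.mk antipodalSetoid) (Subtype.ext hx)
  exact ⟨Continuous.homeoOfEquivCompactToT2 (f := Equiv.ofBijective _ hbij)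
    (hf.quotient_lift hfwd)⟩

/-- An element fixing a point of the sphere but reversing `u` would be the excluded reflection. So
only rotations about `u` have fixed points, namely `u` and `-u` when nontrivial, and a reversing
element puts these two in one orbit. -/
theorem hasTypeProjectivePlaneCone [Finite G] {u : E3} (hG : IsRotoreflectionGroup G u) :
    HasTypeProjectivePlaneCone (Nat.card (pointStab G u)) G := by
  have hu := hG.norm_eq
  have hfixed : ∀ x : S2, ∀ g ∈ isotropy G x, g u = u := by
    rintro x g ⟨hg, hgx⟩
    refine (hG.hasAxis g hg).resolve_right fun h => hG.reflection_not_mem ?_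
    have hr : IsPlaneReflection g := .of_detO_of_apply_eq (hG.detO_of_reversed g hg h)
      (ne_zero_of_norm_eq_one (mem_sphere_zero_iff_norm.1 x.2)) hgx
    rw [← hr.eq_planeReflection hu h]
    exact hg
  refine ⟨?_, fun x g hg => hG.detO_of_fixed g hg.1 (hfixed x g hg),
    ⟨u, mem_sphere_zero_iff_norm.2 hu⟩, rfl, ?_⟩
  · obtain ⟨b, rfl⟩ := exists_orthonormalBasis_axis hu
    exact hG.nonempty_homeomorph
  · intro y hy
    rw [Subgroup.eq_bot_iff_forall]
    intro g hg
    by_contra h1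
    have hgu := hfixed y g hg
    rcases eq_or_eq_neg_of_fixed (hG.detO_of_fixed g hg.1 hgu) h1 hu
      (mem_sphere_zero_iff_norm.1 y.2) hgu hg.2 with h | h
    · exact hy ⟨1, G.one_mem, h.symm⟩
    · obtain ⟨g₀, hg₀, hg₀u⟩ := hG.exists_reversing
      exact hy ⟨g₀, hg₀, hg₀u.trans h.symm⟩

end IsRotoreflectionGroup

/-- Every finite subgroup of `O(3)` has index at most `4` in a finite group generated by
reflections, and index at most `2` unless its spherical orbifold has type `(n|∘)`. -/
theorem mainTheorem3 (G : Subgroup O3) (hG : Finite G) :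
    ∃ G' : Subgroup O3, G ≤ G' ∧ Finite G' ∧ IsReflectionGroup G' ∧
      G.relIndex G' ≤ 4 ∧
      ((¬ ∃ n : ℕ, 1 ≤ n ∧ HasTypeProjectivePlaneCone n G) → G.relIndex G' ≤ 2) := by
  by_cases hax : IsAxial G
  · obtain ⟨u, hu, hGu⟩ := hax
    obtain ⟨G', h1, h2, h3, h4, h5⟩ := exists_reflectionGroup_of_hasAxis hu hGu
    refine ⟨G', h1, h2, h3, h4, fun h => h5 fun hr => h ⟨_, ?_, hr.hasTypeProjectivePlaneCone⟩⟩
    have : Finite (pointStab G u) := Subgroup.finite_of_le (pointStab_le _ _)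
    exact Nat.card_pos
  · obtain ⟨G', h1, h2, h3, h4⟩ := exists_reflectionGroup_of_not_isAxial hax
    exact ⟨G', h1, h2, h3, by omega, fun _ => h4⟩
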